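/- Let $M$ be a smooth manifold (without boundary) of dimension $n+m$ with a smooth Riemannian metric $g=\langle\cdot,\cdot\rangle$, equipped with a foliation with $m$-dimensional leaves for which $g$ is bundle-like. Let $\mathcal V\subset TM$ be the (smooth, involutive, rank $m$) bundle of vectors tangent to the leaves and $\mathcal H=\mathcal V^{\perp}$, and write $u=u_{\mathcal H}+u_{\mathcal V}$ for the orthogonal decomposition of tangent vectors; bundle-like means $(\mathcal L_U g)(X,X)=0$ for all $U\in\mathfrak X(\mathcal V)$, $X\in\mathfrak X(\mathcal H)$. Let $D$ be the Levi-Civita connection of $g$, let $C$ be the tensor defined by $\langle C_XY,Z\rangle=\frac12(\mathcal L_{X_{\mathcal H}}g)(Y_{\mathcal V},Z_{\mathcal V})$, and let $\nabla$ be the adapted connection $$\nabla_XY=\begin{cases}(D_XY)_{\mathcal H}, & X,Y\in\mathfrak X(\mathcal H),\\ [X,Y]_{\mathcal H}, & X\in\mathfrak X(\mathcal V),\ Y\in\mathfrak X(\mathcal H),\\ [X,Y]_{\mathcal V}+C_XY, & X\in\mathfrak X(\mathcal H),\ Y\in\mathfrak X(\mathcal V),\\ (D_XY)_{\mathcal V},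 & X,Y\in\mathfrak X(\mathcal V).\end{cases}$$ Let $\mathrm{Tor}^\nabla(X,Y)=\nabla_XY-\nabla_YX-[X,Y]$ be its torsion, and let $J_Z$ be the skew-symmetric endomorphism with $\langle J_ZX,Y\rangle=\langle Z,\mathrm{Tor}^\nabla(X,Y)\rangle$. For a connection $\bar\nabla$ (namely $D$ or $\nabla$) put $\mathrm{Riem}^{\bar\nabla}(X,Y)Z=\bar\nabla_X\bar\nabla_YZ-\bar\nabla_Y\bar\nabla_XZ-\bar\nabla_{[X,Y]}Z$. Let $r\ge 0$, let $\gamma:[0,r]\to M$ be a unit speed geodesic (that is, $D_{\dot\gamma}\dot\gamma=0$ and $|\dot\gamma|=1$), and let $X$ be a smooth horizontal vector field along $\gamma$ (for instance the restriction to $\gamma$ of a field in $\mathfrak X(\mathcal H)$). Then the index form $$I(\gamma,X)=\int_0^r |D_{\dot\gamma}X|^2-\langle \mathrm{Riem}^D(\dot\gamma,X)X,\dot\gamma\rangle\,dt$$ satisfies $$\begin{aligned}I(\gamma,X)=\int_0^r\ &\Big|\nabla_{\dot\gamma}X+\tfrac12(J_{\dot\gamma}X)_{\mathcal H}\Big|^2-\langle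 \mathrm{Riem}^\nabla(\dot\gamma,X)X,\dot\gamma\rangle+\langle(\nabla_X\mathrm{Tor}^\nabla)(X,\dot\gamma),\dot\gamma_{\mathcal V}\rangle\\ &-\tfrac14\,|(J_{\dot\gamma}X)_{\mathcal H}|^2+|\mathrm{Tor}^\nabla(X,\dot\gamma)|^2+\langle \mathrm{Tor}^\nabla(\mathrm{Tor}^\nabla(\dot\gamma,X),X),\dot\gamma\rangle\,dt.\end{aligned}$$ -/

import Mathlib

open Bundle Set FiberBundle VectorField
open scoped Manifold ContDiff InnerProductSpace Topology

noncomputable section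

set_option linter.unusedSectionVars false

section Geometry

variable {E : Type*} [NormedAddCommGroup E] [NormedSpace ℝ E] [FiniteDimensional ℝ E]
  [CompleteSpace E] {H : Type*} [TopologicalSpace H] {I : ModelWithCorners ℝ E H}
  {M : Type*} [TopologicalSpace M] [ChartedSpace H M]

instance tangentSpace_finiteDimensional (x : M) : FiniteDimensional ℝ (TangentSpace I x) :=
  inferInstanceAs (FiniteDimensional ℝ E)

/-! ### Notions attached to an arbitrary covariant derivative `cov` on `TM`

Mathlib's convention is `cov Y x (X x) = (∇_X Y)(x)`. Tensors are evaluated on tangent vectors at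
`x` by extending the vectors to vector fields that are smooth near `x` (`FiberBundle.extend`). -/

section Connection

variable [IsManifold I ∞ M] (cov : CovariantDerivative I E (TangentSpace I : M → Type _))

/-- The curvature `R(u, v) w = ∇_U ∇_V W - ∇_V ∇_U W - ∇_[U, V] W` at `x`. -/
def CovariantDerivative.curv (x : M) (u v w : TangentSpace I x) : TangentSpace I x :=
  cov (fun y ↦ cov (extend E w) y (extend E v y)) x u
    - cov (fun y ↦ cov (extend E w) y (extend E u y)) x v
    - cov (extend E w) x (mlieBracket I (extend E u) (extend E v) x)

/-- The covariant derivative of the torsion,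
`(∇_u Tor)(v, w) = ∇_u (Tor(V, W)) - Tor(∇_u V, w) - Tor(v, ∇_u W)` at `x`. -/
def CovariantDerivative.derivTorsion (x : M) (u v w : TangentSpace I x) : TangentSpace I x :=
  cov (fun y ↦ cov.torsion y (extend E v y) (extend E w y)) x u
    - cov.torsion x (cov (extend E v) x u) w
    - cov.torsion x v (cov (extend E w) x u)

/-- The velocity `γ'(t)` of a curve defined on a set `s` of parameters. -/
def curveVelocity (I : ModelWithCorners ℝ E H) (s : Set ℝ) (γ : ℝ → M) (t : ℝ) :
    TangentSpace I (γ t) :=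
  mfderivWithin 𝓘(ℝ, ℝ) I γ s t (1 : ℝ)

/-- The covariant derivative `∇_{γ'} X` at time `t` of a vector field `X` along a curve `γ`, both
defined on a set `s` of parameters: if `X = ∑ i, cᵢ • (eᵢ ∘ γ)`, where `(eᵢ)` is the local frame of
`TM` given by the trivialization around `γ t`, it is `∑ i, cᵢ' • eᵢ + ∑ i, cᵢ • ∇_{γ'} eᵢ`. -/
def CovariantDerivative.along (s : Set ℝ) (γ : ℝ → M) (X : (t : ℝ) → TangentSpace I (γ t))
    (t : ℝ) : TangentSpace I (γ t) :=
  (trivializationAt E (TangentSpace I) (γ t)).symm (γ t)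
      (derivWithin (fun τ ↦ (trivializationAt E (TangentSpace I) (γ t) ⟨γ τ, X τ⟩).2) s t)
    + cov (extend E (X t)) (γ t) (curveVelocity I s γ t)

/-- Consistency of the definition: along the restriction to `γ` of a vector field `X` on `M`, the
derivative `∇_{γ'} (X ∘ γ)` is `(∇ X)(γ')`. -/
theorem CovariantDerivative.along_comp {s : Set ℝ} {γ : ℝ → M} {t : ℝ}
    {X : (x : M) → TangentSpace I x} (hX : MDiffAt (T% X) (γ t))
    (hγ : MDifferentiableWithinAt 𝓘(ℝ, ℝ) I γ s t) (hs : UniqueDiffWithinAt ℝ s t) :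
    cov.along s γ (fun τ ↦ X (γ τ)) t = cov X (γ t) (curveVelocity I s γ t) := by
  let e := trivializationAt E (TangentSpace I : M → Type _) (γ t)
  have hmem : γ t ∈ e.baseSet := FiberBundle.mem_baseSet_trivializationAt E _ (γ t)
  have hnear : ∀ᶠ y in 𝓝 (γ t), y ∈ e.baseSet := e.open_baseSet.mem_nhds hmem
  let c (Y : (x : M) → TangentSpace I x) (y : M) : E := (e ⟨y, Y y⟩).2
  have hc {Y : (x : M) → TangentSpace I x} (hY : MDiffAt (T% Y) (γ t)) :
      MDifferentiableAt I 𝓘(ℝ, E) (c Y) (γ t) :=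
    (e.mdifferentiableAt_section_iff I Y hmem).1 hY
  let u := curveVelocity I s γ t
  let Φ (Y : (x : M) → TangentSpace I x) : TangentSpace I (γ t) :=
    cov Y (γ t) u - e.symmL ℝ (γ t) (mvfderiv I (c Y) (γ t) u)
  have hΦ : TensorialAt I E Φ (γ t) :=
    { smul := by
        intro f Y hf hY
        have h1 : c (f • Y) =ᶠ[𝓝 (γ t)] fun y ↦ f y • c Y y := by
          filter_upwards [hnear] with y hy
          exact (e.linear ℝ hy).map_smul (f y) (Y y)
        have h2 : mvfderiv I (c (f • Y)) (γ t) = mvfderiv I (fun y ↦ f y • c Y y) (γ t) :=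
          h1.mfderiv_eq
        have h3 := cov.isCovariantDerivativeOnUniv.leibniz hY hf
        have h4 : e.symmL ℝ (γ t) (c Y (γ t)) = Y (γ t) := by
          simp [c, hmem]
        have h5 := mvfderiv_fun_smul hf (hc hY)
        simp [Φ, h2, h3, h4, h5]
        module
      add := by
        intro Y Y' hY hY'
        have h1 : c (Y + Y') =ᶠ[𝓝 (γ t)] fun y ↦ c Y y + c Y' y := by
          filter_upwards [hnear] with y hy
          exact (e.linear ℝ hy).map_add (Y y) (Y' y)
        have h2 : mvfderiv I (c (Y + Y')) (γ t) = mvfderiv I (fun y ↦ c Y y + c Y' y) (γ t) :=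
          h1.mfderiv_eq
        have h3 := cov.isCovariantDerivativeOnUniv.add hY hY'
        have h5 := mvfderiv_fun_add (hc hY) (hc hY')
        simp [Φ, h2, h3, h5]
        module }
  have hE := mdifferentiableAt_extend I E (X (γ t))
  have hpt := hΦ.pointwise hE hX (extend_apply_self E (X (γ t)))
  have hconst : mvfderiv I (c (extend E (X (γ t)))) (γ t) = 0 := by
    have h1 : c (extend E (X (γ t))) =ᶠ[𝓝 (γ t)] fun _ ↦ c X (γ t) := by
      filter_upwards [hnear] with y hy
      simp [c, extend, e, e.apply_mk_symm hy]
    have h2 : mvfderiv I (c (extend E (X (γ t)))) (γ t) = mvfderiv I (fun _ ↦ c X (γ t)) (γ t) :=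
      h1.mfderiv_eq
    rw [h2]
    simp [mvfderiv]
  have hchain : derivWithin (fun τ ↦ c X (γ τ)) s t = mvfderiv I (c X) (γ t) u := by
    have h1 := mfderiv_comp_mfderivWithin t (hc hX) hγ hs.uniqueMDiffWithinAt
    have h2 : derivWithin (c X ∘ γ) s t = mfderivWithin 𝓘(ℝ, ℝ) 𝓘(ℝ, E) (c X ∘ γ) s t (1 : ℝ) := by
      rw [mfderivWithin_eq_fderivWithin]; rfl
    change derivWithin (c X ∘ γ) s t = _
    rw [h2, h1]
    rfl
  simp only [Φ, hconst] at hpt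
  have hgoal : cov.along s γ (fun τ ↦ X (γ τ)) t = e.symmL ℝ (γ t)
      (derivWithin (fun τ ↦ c X (γ τ)) s t) + cov (extend E (X (γ t))) (γ t) u := by
    rw [e.symmL_apply hmem]; rfl
  rw [hgoal, hchain]
  simp at hpt
  rw [hpt]
  abel

end Connection

variable [RiemannianBundle (fun x : M ↦ TangentSpace I x)]

/-- The endomorphism `J_z` of `T_x M` with `⟪J_z u, v⟫ = ⟪z, Tor(u, v)⟫`. -/
def CovariantDerivative.J [IsManifold I ∞ M]
    (cov : CovariantDerivative I E (TangentSpace I : M → Type _))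
    (x : M) (z u : TangentSpace I x) : TangentSpace I x :=
  haveI : CompleteSpace (TangentSpace I x) := FiniteDimensional.complete ℝ _
  ContinuousLinearMap.adjoint (cov.torsion x u) z

theorem CovariantDerivative.inner_J [IsManifold I ∞ M]
    (cov : CovariantDerivative I E (TangentSpace I : M → Type _))
    (x : M) (z u v : TangentSpace I x) :
    ⟪cov.J x z u, v⟫_ℝ = ⟪z, cov.torsion x u v⟫_ℝ := by
  have : CompleteSpace (TangentSpace I x) := FiniteDimensional.complete ℝ _
  exact ContinuousLinearMap.adjoint_inner_left (cov.torsion x u) v z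

/-- The Lie derivative of the metric,
`(𝓛_X g)(Y, Z) = X ⟪Y, Z⟫ - ⟪[X, Y], Z⟫ - ⟪Y, [X, Z]⟫` at `x`. -/
def lieDerivMetric (X Y Z : (x : M) → TangentSpace I x) (x : M) : ℝ :=
  mvfderiv I (fun y ↦ ⟪Y y, Z y⟫_ℝ) x (X x)
    - ⟪mlieBracket I X Y x, Z x⟫_ℝ - ⟪Y x, mlieBracket I X Z x⟫_ℝ

/-! ### The Levi-Civita connection -/

section LeviCivita

/-- The right-hand side of the Koszul formula, divided by two. -/
def koszul (X Y Z : (x : M) → TangentSpace I x) (x : M) : ℝ :=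
  (1 / 2) * (mvfderiv I (fun y ↦ ⟪Y y, Z y⟫_ℝ) x (X x) + mvfderiv I (fun y ↦ ⟪Z y, X y⟫_ℝ) x (Y x)
    - mvfderiv I (fun y ↦ ⟪X y, Y y⟫_ℝ) x (Z x)
    + ⟪mlieBracket I X Y x, Z x⟫_ℝ - ⟪mlieBracket I Y Z x, X x⟫_ℝ
    + ⟪mlieBracket I Z X x, Y x⟫_ℝ)

variable [IsManifold I ∞ M] [IsContMDiffRiemannianBundle I ∞ E (fun x : M ↦ TangentSpace I x)]

theorem contMDiffRiemannian_one :
    IsContMDiffRiemannianBundle I 1 E (fun x : M ↦ TangentSpace I x) :=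
  IsContMDiffRiemannianBundle.of_le (n := ∞) (by norm_num)

theorem mdifferentiableAt_inner {Y Z : (x : M) → TangentSpace I x} {x : M}
    (hY : MDiffAt (T% Y) x) (hZ : MDiffAt (T% Z) x) : MDiffAt (fun y ↦ ⟪Y y, Z y⟫_ℝ) x := by
  have := contMDiffRiemannian_one (I := I) (M := M)
  exact MDifferentiableAt.inner_bundle (E := fun x : M ↦ TangentSpace I x) (b := id) hY hZ

theorem koszul_tensorial_left {Y Z : (x : M) → TangentSpace I x} {x : M}
    (hY : MDiffAt (T% Y) x) (hZ : MDiffAt (T% Z) x) :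
    TensorialAt I E (fun X ↦ koszul X Y Z x) x where
  smul {f X} hf hX := by
    have h1 := mvfderiv_fun_mul hf (mdifferentiableAt_inner hZ hX)
    have h2 := mvfderiv_fun_mul hf (mdifferentiableAt_inner hX hY)
    simp [koszul, inner_smul_left, inner_smul_right, h1, h2, mlieBracket_smul_left hf hX,
      mlieBracket_smul_right hf hX, inner_add_left, real_inner_comm (X x)]
    ring
  add {X X'} hX hX' := by
    have h1 := mvfderiv_fun_add (mdifferentiableAt_inner hZ hX) (mdifferentiableAt_inner hZ hX')
    have h2 := mvfderiv_fun_add (mdifferentiableAt_inner hX hY) (mdifferentiableAt_inner hX' hY)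
    simp [koszul, inner_add_left, inner_add_right, h1, h2, mlieBracket_add_left hX hX',
      mlieBracket_add_right hX hX']
    ring

theorem koszul_tensorial_right {X Y : (x : M) → TangentSpace I x} {x : M}
    (hX : MDiffAt (T% X) x) (hY : MDiffAt (T% Y) x) :
    TensorialAt I E (fun Z ↦ koszul X Y Z x) x where
  smul {f Z} hf hZ := by
    have h1 := mvfderiv_fun_mul hf (mdifferentiableAt_inner hY hZ)
    have h2 := mvfderiv_fun_mul hf (mdifferentiableAt_inner hZ hX)
    simp [koszul, inner_smul_left, inner_smul_right, h1, h2, mlieBracket_smul_left hf hZ,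
      mlieBracket_smul_right hf hZ, inner_add_left, real_inner_comm (Z x)]
    ring
  add {Z Z'} hZ hZ' := by
    have h1 := mvfderiv_fun_add (mdifferentiableAt_inner hY hZ) (mdifferentiableAt_inner hY hZ')
    have h2 := mvfderiv_fun_add (mdifferentiableAt_inner hZ hX) (mdifferentiableAt_inner hZ' hX)
    simp [koszul, inner_add_left, inner_add_right, h1, h2, mlieBracket_add_left hZ hZ',
      mlieBracket_add_right hZ hZ']
    ring

theorem koszul_add {X Y Y' Z : (x : M) → TangentSpace I x} {x : M} (hX : MDiffAt (T% X) x)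
    (hY : MDiffAt (T% Y) x) (hY' : MDiffAt (T% Y') x) (hZ : MDiffAt (T% Z) x) :
    koszul X (Y + Y') Z x = koszul X Y Z x + koszul X Y' Z x := by
  have h1 := mvfderiv_fun_add (mdifferentiableAt_inner hY hZ) (mdifferentiableAt_inner hY' hZ)
  have h2 := mvfderiv_fun_add (mdifferentiableAt_inner hX hY) (mdifferentiableAt_inner hX hY')
  simp [koszul, inner_add_left, inner_add_right, h1, h2, mlieBracket_add_left hY hY',
    mlieBracket_add_right hY hY']
  ring

theorem koszul_smul {f : M → ℝ} {X Y Z : (x : M) → TangentSpace I x} {x : M}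
    (hf : MDiffAt f x) (hX : MDiffAt (T% X) x)
    (hY : MDiffAt (T% Y) x) (hZ : MDiffAt (T% Z) x) :
    koszul X (f • Y) Z x = f x * koszul X Y Z x + mvfderiv I f x (X x) * ⟪Y x, Z x⟫_ℝ := by
  have h1 := mvfderiv_fun_mul hf (mdifferentiableAt_inner hY hZ)
  have h2 := mvfderiv_fun_mul hf (mdifferentiableAt_inner hX hY)
  simp [koszul, inner_smul_left, inner_smul_right, h1, h2, mlieBracket_smul_left hf hY,
    mlieBracket_smul_right hf hY, inner_add_left, real_inner_comm (Y x)]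
  ring

open Classical in
/-- The bilinear form `(u, w) ↦ ⟪D_u Y, w⟫` on `T_x M`, given by the Koszul formula. -/
def koszulForm (Y : (x : M) → TangentSpace I x) (x : M) :
    TangentSpace I x →L[ℝ] TangentSpace I x →L[ℝ] ℝ :=
  if hY : MDiffAt (T% Y) x then
    TensorialAt.mkHom₂ (F := E) (F' := E) (fun X Z ↦ koszul X Y Z x) x
      (fun _ hZ ↦ koszul_tensorial_left hY hZ) (fun _ hX ↦ koszul_tensorial_right hX hY)
  else 0

theorem koszulForm_apply {Y : (x : M) → TangentSpace I x} {x : M} (hY : MDiffAt (T% Y) x)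
    (u w : TangentSpace I x) : koszulForm Y x u w = koszul (extend E u) Y (extend E w) x := by
  rw [koszulForm, dif_pos hY, TensorialAt.mkHom₂_apply_eq_extend]

/-- The vector-valued linear map `A` with `⟪A u, w⟫ = B u w`. -/
def rieszMap {x : M} (B : TangentSpace I x →L[ℝ] TangentSpace I x →L[ℝ] ℝ) :
    TangentSpace I x →L[ℝ] TangentSpace I x :=
  ∑ i, (B.flip (stdOrthonormalBasis ℝ (TangentSpace I x) i)).smulRight
    (stdOrthonormalBasis ℝ (TangentSpace I x) i)

theorem inner_rieszMap {x : M} (B : TangentSpace I x →L[ℝ] TangentSpace I x →L[ℝ] ℝ)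
    (u w : TangentSpace I x) : ⟪rieszMap B u, w⟫_ℝ = B u w := by
  conv_rhs => rw [← (stdOrthonormalBasis ℝ (TangentSpace I x)).sum_repr' w]
  simp [rieszMap, sum_inner, inner_smul_left, mul_comm]

variable (I M) in
/-- The Levi-Civita connection `D` of the metric, defined by the Koszul formula
`2⟪D_X Y, Z⟫ = X⟪Y, Z⟫ + Y⟪Z, X⟫ - Z⟪X, Y⟫ + ⟪[X, Y], Z⟫ - ⟪[Y, Z], X⟫ + ⟪[Z, X], Y⟫`. -/
def leviCivita : CovariantDerivative I E (TangentSpace I : M → Type _) where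
  toFun Y x := rieszMap (koszulForm Y x)
  isCovariantDerivativeOnUniv :=
    { add := by
        intro Y Y' x hY hY' _
        ext u
        refine ext_inner_right ℝ fun w ↦ ?_
        have h := mdifferentiableAt_add_section hY hY'
        have hu := mdifferentiableAt_extend I E u
        have hw := mdifferentiableAt_extend I E w
        simp [inner_rieszMap, inner_add_left, koszulForm_apply hY, koszulForm_apply hY',
          koszulForm_apply (Y := Y + Y') h, koszul_add hu hY hY' hw]
      leibniz := by
        intro Y f x hY hf _
        ext u
        refine ext_inner_right ℝ fun w ↦ ?_
        have h := hf.smul_section hY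
        have hu := mdifferentiableAt_extend I E u
        have hw := mdifferentiableAt_extend I E w
        simp [inner_rieszMap, inner_add_left, inner_smul_left, koszulForm_apply hY,
          koszulForm_apply (Y := f • Y) h, koszul_smul hf hu hY hw] }

/-- The Koszul formula. -/
theorem inner_leviCivita {X Y Z : (x : M) → TangentSpace I x} {x : M} (hX : MDiffAt (T% X) x)
    (hY : MDiffAt (T% Y) x) (hZ : MDiffAt (T% Z) x) :
    ⟪leviCivita I M Y x (X x), Z x⟫_ℝ = koszul X Y Z x := by
  change ⟪rieszMap (koszulForm Y x) (X x), Z x⟫_ℝ = _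
  rw [inner_rieszMap, koszulForm, dif_pos hY]
  exact TensorialAt.mkHom₂_apply (fun _ hZ ↦ koszul_tensorial_left hY hZ)
    (fun _ hX ↦ koszul_tensorial_right hX hY) hX hZ

end LeviCivita

/-! ### Riemannian foliations and their adapted connection -/

section Foliation

variable (I M) in
/-- A foliation of `M` with `m`-dimensional leaves for which the metric is bundle-like, given by
its vertical bundle `𝒱`, the bundle of vectors tangent to the leaves. Thus `𝒱` is a smooth
(i.e. the field of orthogonal projections onto `𝒱` is a smooth field of endomorphisms of `TM`)
involutive subbundle of rank `m` of `TM`. The horizontal bundle is `ℋ = 𝒱ᗮ`. The last two conditions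
are imposed on vector fields that are smooth near an arbitrary point. -/
structure RiemannianFoliation [IsManifold I ∞ M] (m : ℕ) where
  vertical : (x : M) → Submodule ℝ (TangentSpace I x)
  finrank_vertical : ∀ x, Module.finrank ℝ (vertical x) = m
  smooth_vertical : ContMDiff I (I.prod 𝓘(ℝ, E →L[ℝ] E)) ∞ (fun x ↦ TotalSpace.mk' (E →L[ℝ] E)
    (E := fun x : M ↦ TangentSpace I x →L[ℝ] TangentSpace I x) x (vertical x).starProjection)
  involutive : ∀ (U W : (x : M) → TangentSpace I x),
    (∀ y, U y ∈ vertical y) → (∀ y, W y ∈ vertical y) →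
    ∀ x, CMDiffAt ∞ (T% U) x → CMDiffAt ∞ (T% W) x → mlieBracket I U W x ∈ vertical x
  bundleLike : ∀ (U X : (x : M) → TangentSpace I x),
    (∀ y, U y ∈ vertical y) → (∀ y, X y ∈ (vertical y)ᗮ) →
    ∀ x, CMDiffAt ∞ (T% U) x → CMDiffAt ∞ (T% X) x → lieDerivMetric U X X x = 0

namespace RiemannianFoliation

variable [IsManifold I ∞ M] {m : ℕ} (F : RiemannianFoliation I M m)

/-- The horizontal space `ℋ_x = 𝒱_xᗮ`. -/
def horizontal (x : M) : Submodule ℝ (TangentSpace I x) := (F.vertical x)ᗮ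

/-- The vertical part `u_𝒱` of a tangent vector. -/
def vert (x : M) : TangentSpace I x →L[ℝ] TangentSpace I x := (F.vertical x).starProjection

/-- The horizontal part `u_ℋ` of a tangent vector. -/
def hor (x : M) : TangentSpace I x →L[ℝ] TangentSpace I x := (F.horizontal x).starProjection

/-- The vertical part of a vector field. -/
def vertField (X : (x : M) → TangentSpace I x) (x : M) : TangentSpace I x := F.vert x (X x)

/-- The horizontal part of a vector field. -/
def horField (X : (x : M) → TangentSpace I x) (x : M) : TangentSpace I x := F.hor x (X x)

/-- The tensor `C`: the vector `C_X Y` at `x` is the one such that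
`⟪C_X Y, Z⟫ = (1 / 2) (𝓛_{X_ℋ} g)(Y_𝒱, Z_𝒱)` for all `Z`, here written out in an orthonormal basis
of `T_x M`. -/
def tensorC (X Y : (x : M) → TangentSpace I x) (x : M) : TangentSpace I x :=
  ∑ i, ((1 / 2 : ℝ) * lieDerivMetric (F.horField X) (F.vertField Y)
      (F.vertField (extend E (stdOrthonormalBasis ℝ (TangentSpace I x) i))) x) •
    stdOrthonormalBasis ℝ (TangentSpace I x) i

theorem hor_add_vert (x : M) (u : TangentSpace I x) : F.hor x u + F.vert x u = u := by
  rw [add_comm]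
  exact (F.vertical x).starProjection_add_starProjection_orthogonal u

theorem hor_eq (x : M) (u : TangentSpace I x) : F.hor x u = u - F.vert x u :=
  eq_sub_of_add_eq (F.hor_add_vert x u)

@[simp] theorem vert_vert (x : M) (u : TangentSpace I x) : F.vert x (F.vert x u) = F.vert x u :=
  Submodule.starProjection_eq_self_iff.2 (Submodule.starProjection_apply_mem _ _)

@[simp] theorem vert_hor (x : M) (u : TangentSpace I x) : F.vert x (F.hor x u) = 0 := by
  simp [hor_eq]

@[simp] theorem hor_vert (x : M) (u : TangentSpace I x) : F.hor x (F.vert x u) = 0 := by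
  simp [hor_eq]

@[simp] theorem hor_hor (x : M) (u : TangentSpace I x) : F.hor x (F.hor x u) = F.hor x u := by
  simp [hor_eq]

@[simp] theorem inner_hor_vert (x : M) (u w : TangentSpace I x) :
    ⟪F.hor x u, F.vert x w⟫_ℝ = 0 :=
  Submodule.inner_left_of_mem_orthogonal (Submodule.starProjection_apply_mem _ _)
    (Submodule.starProjection_apply_mem _ _)

@[simp] theorem inner_vert_hor (x : M) (u w : TangentSpace I x) :
    ⟪F.vert x u, F.hor x w⟫_ℝ = 0 := by
  rw [real_inner_comm, inner_hor_vert]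

theorem vertField_add (X Y : (x : M) → TangentSpace I x) :
    F.vertField (X + Y) = F.vertField X + F.vertField Y := by
  ext x; simp [vertField]

theorem horField_add (X Y : (x : M) → TangentSpace I x) :
    F.horField (X + Y) = F.horField X + F.horField Y := by
  ext x; simp [horField]

theorem vertField_smul (f : M → ℝ) (X : (x : M) → TangentSpace I x) :
    F.vertField (f • X) = f • F.vertField X := by
  ext x; simp [vertField]

theorem horField_smul (f : M → ℝ) (X : (x : M) → TangentSpace I x) :
    F.horField (f • X) = f • F.horField X := by
  ext x; simp [horField]

theorem mdifferentiableAt_vertField {X : (x : M) → TangentSpace I x} {x : M}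
    (hX : MDiffAt (T% X) x) : MDiffAt (T% (F.vertField X)) x :=
  MDifferentiableAt.clm_bundle_apply (F₁ := E) (F₂ := E) (b := id)
    (E₁ := fun x : M ↦ TangentSpace I x) (E₂ := fun x : M ↦ TangentSpace I x)
    ((F.smooth_vertical x).mdifferentiableAt (by simp)) hX

theorem mdifferentiableAt_horField {X : (x : M) → TangentSpace I x} {x : M}
    (hX : MDiffAt (T% X) x) : MDiffAt (T% (F.horField X)) x := by
  have h := mdifferentiableAt_sub_section hX (F.mdifferentiableAt_vertField hX)
  have h' : F.horField X = X - F.vertField X := by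
    ext x; simp [horField, vertField, hor_eq]
  rw [h']
  exact h

variable [IsContMDiffRiemannianBundle I ∞ E (fun x : M ↦ TangentSpace I x)]

/-- The adapted connection `∇_X Y` at `x`, as a function of the vector fields `X` and `Y`: it is
`(D_X Y)_ℋ` for `X, Y` horizontal, `[X, Y]_ℋ` for `X` vertical and `Y` horizontal,
`[X, Y]_𝒱 + C_X Y` for `X` horizontal and `Y` vertical, `(D_X Y)_𝒱` for `X, Y` vertical. -/
def adaptedFun (X Y : (x : M) → TangentSpace I x) (x : M) : TangentSpace I x :=
  F.hor x (leviCivita I M (F.horField Y) x (F.horField X x))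
    + F.hor x (mlieBracket I (F.vertField X) (F.horField Y) x)
    + (F.vert x (mlieBracket I (F.horField X) (F.vertField Y) x) + F.tensorC X Y x)
    + F.vert x (leviCivita I M (F.vertField Y) x (F.vertField X x))

theorem tensorC_add_left {X X' Y : (x : M) → TangentSpace I x} {x : M}
    (hX : MDiffAt (T% X) x) (hX' : MDiffAt (T% X') x) :
    F.tensorC (X + X') Y x = F.tensorC X Y x + F.tensorC X' Y x := by
  simp only [tensorC, ← Finset.sum_add_distrib, ← add_smul]
  congr! 2 with i
  rw [horField_add]
  simp [lieDerivMetric, mlieBracket_add_left (F.mdifferentiableAt_horField hX)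
    (F.mdifferentiableAt_horField hX'), inner_add_left, inner_add_right]
  ring

theorem tensorC_smul_left {f : M → ℝ} {X Y : (x : M) → TangentSpace I x} {x : M}
    (hf : MDiffAt f x) (hX : MDiffAt (T% X) x) :
    F.tensorC (f • X) Y x = f x • F.tensorC X Y x := by
  simp only [tensorC, Finset.smul_sum, smul_smul]
  congr! 2 with i
  rw [horField_smul]
  have h1 : ∀ Z W : (x : M) → TangentSpace I x, ⟪F.horField Z x, F.vertField W x⟫_ℝ = 0 :=
    fun Z W ↦ F.inner_hor_vert x _ _
  have h2 : ∀ Z W : (x : M) → TangentSpace I x, ⟪F.vertField Z x, F.horField W x⟫_ℝ = 0 :=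
    fun Z W ↦ F.inner_vert_hor x _ _
  simp [lieDerivMetric, mlieBracket_smul_left hf (F.mdifferentiableAt_horField hX),
    inner_add_left, inner_add_right, inner_smul_left, inner_smul_right, h1, h2]
  ring

theorem tensorC_add_right {X Y Y' : (x : M) → TangentSpace I x} {x : M}
    (hY : MDiffAt (T% Y) x) (hY' : MDiffAt (T% Y') x) :
    F.tensorC X (Y + Y') x = F.tensorC X Y x + F.tensorC X Y' x := by
  simp only [tensorC, ← Finset.sum_add_distrib, ← add_smul]
  congr! 2 with i
  rw [vertField_add]
  have hZ := F.mdifferentiableAt_vertField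
    (mdifferentiableAt_extend I E (stdOrthonormalBasis ℝ (TangentSpace I x) i))
  have h := mvfderiv_fun_add (mdifferentiableAt_inner (F.mdifferentiableAt_vertField hY) hZ)
    (mdifferentiableAt_inner (F.mdifferentiableAt_vertField hY') hZ)
  simp [lieDerivMetric, mlieBracket_add_right (F.mdifferentiableAt_vertField hY)
    (F.mdifferentiableAt_vertField hY'), inner_add_left, h]
  ring

theorem tensorC_smul_right {f : M → ℝ} {X Y : (x : M) → TangentSpace I x} {x : M}
    (hf : MDiffAt f x) (hY : MDiffAt (T% Y) x) :
    F.tensorC X (f • Y) x = f x • F.tensorC X Y x := by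
  simp only [tensorC, Finset.smul_sum, smul_smul]
  congr! 2 with i
  rw [vertField_smul]
  have hZ := F.mdifferentiableAt_vertField
    (mdifferentiableAt_extend I E (stdOrthonormalBasis ℝ (TangentSpace I x) i))
  have h := mvfderiv_fun_mul hf (mdifferentiableAt_inner (F.mdifferentiableAt_vertField hY) hZ)
  simp [lieDerivMetric, mlieBracket_smul_right hf (F.mdifferentiableAt_vertField hY),
    inner_add_left, inner_smul_left, h]
  ring

theorem adaptedFun_tensorial (Y : (x : M) → TangentSpace I x) (x : M) :
    TensorialAt I E (fun X ↦ F.adaptedFun X Y x) x where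
  smul {f X} hf hX := by
    simp [adaptedFun, F.tensorC_smul_left hf hX, horField_smul, vertField_smul,
      mlieBracket_smul_left hf (F.mdifferentiableAt_horField hX),
      mlieBracket_smul_left hf (F.mdifferentiableAt_vertField hX)]
    simp [horField, vertField]
  add {X X'} hX hX' := by
    simp [adaptedFun, F.tensorC_add_left hX hX', horField_add, vertField_add,
      mlieBracket_add_left (F.mdifferentiableAt_horField hX) (F.mdifferentiableAt_horField hX'),
      mlieBracket_add_left (F.mdifferentiableAt_vertField hX) (F.mdifferentiableAt_vertField hX')]
    abel

theorem adaptedFun_add {X Y Y' : (x : M) → TangentSpace I x} {x : M}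
    (hY : MDiffAt (T% Y) x) (hY' : MDiffAt (T% Y') x) :
    F.adaptedFun X (Y + Y') x = F.adaptedFun X Y x + F.adaptedFun X Y' x := by
  have hh := (leviCivita I M).isCovariantDerivativeOnUniv.add (F.mdifferentiableAt_horField hY)
    (F.mdifferentiableAt_horField hY')
  have hv := (leviCivita I M).isCovariantDerivativeOnUniv.add (F.mdifferentiableAt_vertField hY)
    (F.mdifferentiableAt_vertField hY')
  simp [adaptedFun, F.tensorC_add_right hY hY', horField_add, vertField_add, hh, hv,
    mlieBracket_add_right (F.mdifferentiableAt_horField hY) (F.mdifferentiableAt_horField hY'),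
    mlieBracket_add_right (F.mdifferentiableAt_vertField hY) (F.mdifferentiableAt_vertField hY')]
  abel

theorem adaptedFun_smul {f : M → ℝ} {X Y : (x : M) → TangentSpace I x} {x : M}
    (hf : MDiffAt f x) (hY : MDiffAt (T% Y) x) :
    F.adaptedFun X (f • Y) x = f x • F.adaptedFun X Y x + mvfderiv I f x (X x) • Y x := by
  have hh := (leviCivita I M).isCovariantDerivativeOnUniv.leibniz
    (F.mdifferentiableAt_horField hY) hf
  have hv := (leviCivita I M).isCovariantDerivativeOnUniv.leibniz
    (F.mdifferentiableAt_vertField hY) hf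
  have key : mvfderiv I f x (X x) • Y x =
      (mvfderiv I f x (F.hor x (X x)) + mvfderiv I f x (F.vert x (X x))) •
        (F.hor x (Y x) + F.vert x (Y x)) := by
    rw [← map_add, hor_add_vert, hor_add_vert]
  rw [key]
  simp [adaptedFun, F.tensorC_smul_right hf hY, horField_smul, vertField_smul, hh, hv,
    mlieBracket_smul_right hf (F.mdifferentiableAt_horField hY),
    mlieBracket_smul_right hf (F.mdifferentiableAt_vertField hY)]
  simp only [horField, vertField, hor_hor, vert_vert]
  module

/-- The adapted connection `∇` of the foliation, as a covariant derivative. -/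
def adapted : CovariantDerivative I E (TangentSpace I : M → Type _) where
  toFun Y x := TensorialAt.mkHom (F := E) (fun X ↦ F.adaptedFun X Y x) x
    (F.adaptedFun_tensorial Y x)
  isCovariantDerivativeOnUniv :=
    { add := by
        intro Y Y' x hY hY' _
        ext u
        simp [TensorialAt.mkHom_apply_eq_extend, F.adaptedFun_add hY hY']
      leibniz := by
        intro Y f x hY hf _
        ext u
        simp [TensorialAt.mkHom_apply_eq_extend, F.adaptedFun_smul hf hY] }

/-- On vector fields, `∇_X Y` is given by the defining formula of the adapted connection. -/
theorem adapted_apply {X : (x : M) → TangentSpace I x} (Y : (x : M) → TangentSpace I x) {x : M}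
    (hX : MDiffAt (T% X) x) : F.adapted Y x (X x) = F.adaptedFun X Y x :=
  TensorialAt.mkHom_apply (F.adaptedFun_tensorial Y x) hX

end RiemannianFoliation

end Foliation

/-! ### Geodesics and the index form -/

section Index

variable [IsManifold I ∞ M] [IsContMDiffRiemannianBundle I ∞ E (fun x : M ↦ TangentSpace I x)]

variable (I) in
/-- `γ : [0, r] → M` is a unit speed geodesic of the metric. -/
structure IsUnitSpeedGeodesic (γ : ℝ → M) (r : ℝ) : Prop where
  smooth : ContMDiffOn 𝓘(ℝ, ℝ) I ∞ γ (Icc 0 r)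
  unit_speed : ∀ t ∈ Icc 0 r, ‖curveVelocity I (Icc 0 r) γ t‖ = 1
  geodesic : ∀ t ∈ Icc 0 r,
    (leviCivita I M).along (Icc 0 r) γ (curveVelocity I (Icc 0 r) γ) t = 0

/-- The index form
`I(γ, X) = ∫₀ʳ |D_{γ'} X|² - ⟪Riem^D(γ', X) X, γ'⟫ dt` of a vector field `X` along `γ`. -/
def indexForm (γ : ℝ → M) (r : ℝ) (X : (t : ℝ) → TangentSpace I (γ t)) : ℝ :=
  ∫ t in (0 : ℝ)..r,
    (‖(leviCivita I M).along (Icc 0 r) γ X t‖ ^ 2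
      - ⟪(leviCivita I M).curv (γ t) (curveVelocity I (Icc 0 r) γ t) (X t) (X t),
          curveVelocity I (Icc 0 r) γ t⟫_ℝ)

end Index

end Geometry

end

set_option linter.unusedSectionVars false

section IndexFormula

variable {E : Type*} [NormedAddCommGroup E] [NormedSpace ℝ E] [FiniteDimensional ℝ E]
  [CompleteSpace E] {H : Type*} [TopologicalSpace H] {I : ModelWithCorners ℝ E H}
  {M : Type*} [TopologicalSpace M] [ChartedSpace H M] [IsManifold I ∞ M]

/-! ### Smoothness of vector fields and their derivatives -/

/-! The two integrands agree at every time, so the statement is a pointwise tensor identity. Write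
`v` for the velocity, `u` for the horizontal value of `X`, `T` for the torsion of `∇`, and `A_u w =
∇_u w - D_u w` (`contorsion`).

Three facts about `∇` carry the proof: it is metric (`mvfderiv_inner_adapted`, which uses the
bundle-like condition), its torsion is vertical (`hor_torsion`, which uses involutivity), and it
preserves the splitting into horizontal and vertical parts (`adapted_vertField`,
`adapted_horField`). Since `D` is metric and torsion-free, `A_u` is skew and the antisymmetric part
of `A` is `T`; Koszul's trick then expresses `A` through `T` (`inner_contorsion`). For horizontal
`u`, verticality of `T` gives `A_u u = 0` and `2 A_v u = T(v, u) - J_v u`.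

Expanding `D = ∇ - A` twice compares the curvatures (`inner_curv_leviCivita`). For the derivative
term, `a = ∇_v X` is horizontal (`hor_along`), so in `|a - A_v u|²` only the horizontal part of `J_v
u` pairs with `a`; completing the square produces `|a + ½ (J_v u)_ℋ|² - ¼ |(J_v u)_ℋ|² + |A_v u|²`.
The last term cancels against the curvature comparison, and `2⟪A_v u, T(v, u)⟫ = |T(v, u)|² +
⟪T(T(v, u), u), v⟫` supplies the remaining torsion terms (`indexForm_integrand_eq`).

Differentiating these expressions requires `D`, `∇` and `T` to send smooth fields to smooth fields.
This is checked by pairing with test fields (`contMDiffAt_of_contMDiffAt_inner`), because the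
connections are given by formulas for such pairings. -/

theorem contMDiffAt_mvfderiv_apply {f : M → ℝ} {X : (x : M) → TangentSpace I x} {x : M}
    (hf : CMDiffAt ∞ f x) (hX : CMDiffAt ∞ (T% X) x) :
    CMDiffAt ∞ (fun y ↦ mvfderiv I f y (X y)) x := by
  have h1 : ContMDiffAt I (𝓘(ℝ, ℝ).prod 𝓘(ℝ, ℝ)) ∞
      (fun y ↦ (⟨f y, mfderiv I 𝓘(ℝ, ℝ) f y (X y)⟩ : TangentBundle 𝓘(ℝ, ℝ) ℝ)) x :=
    ContMDiffAt.clm_apply_of_inCoordinates (hf.mfderiv_const le_rfl) hX hf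
  simpa using! (contMDiffAt_totalSpace.1 h1).2

variable [RiemannianBundle (fun x : M ↦ TangentSpace I x)]
  [IsContMDiffRiemannianBundle I ∞ E (fun x : M ↦ TangentSpace I x)]

theorem contMDiffAt_inner {Y Z : (x : M) → TangentSpace I x} {x : M}
    (hY : CMDiffAt ∞ (T% Y) x) (hZ : CMDiffAt ∞ (T% Z) x) :
    CMDiffAt ∞ (fun y ↦ ⟪Y y, Z y⟫_ℝ) x :=
  ContMDiffAt.inner_bundle (E := fun x : M ↦ TangentSpace I x) (b := id) hY hZ

/-- A vector field is smooth as soon as its inner products with smooth vector fields are. -/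
theorem contMDiffAt_of_contMDiffAt_inner {W : (x : M) → TangentSpace I x} {x : M}
    (h : ∀ Z : (x : M) → TangentSpace I x, CMDiffAt ∞ (T% Z) x →
      CMDiffAt ∞ (fun y ↦ ⟪W y, Z y⟫_ℝ) x) : CMDiffAt ∞ (T% W) x := by
  let e := trivializationAt E (TangentSpace I : M → Type _) x
  have hx : x ∈ e.baseSet := FiberBundle.mem_baseSet_trivializationAt' x
  let b := Module.finBasis ℝ E
  let s := e.localFrame b
  have hs (i) : CMDiffAt ∞ (T% (s i)) x := contMDiffAt_localFrame_of_mem ∞ e b i hx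
  let ι := Fin (Module.finrank ℝ E)
  let K (i j : ι) : (ι → ℝ) →L[ℝ] (ι → ℝ) :=
    (ContinuousLinearMap.proj j).smulRight (Pi.single i (1 : ℝ))
  -- The Gram operator of the frame: it sends the coefficients of a vector to its inner products
  -- with the frame. Recovering `W` from the pairings amounts to inverting it, and inversion is a
  -- smooth operation.
  let L (y : M) : (ι → ℝ) →L[ℝ] (ι → ℝ) := ∑ i, ∑ j, ⟪s j y, s i y⟫_ℝ • K i j
  have hLapply (y : M) (c : ι → ℝ) (i : ι) : L y c i = ⟪∑ j, c j • s j y, s i y⟫_ℝ := by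
    simp [L, K, sum_inner, inner_smul_left, Finset.sum_apply, Pi.single_apply,
      Finset.sum_ite_eq, mul_comm]
    rfl
  have hL : ContMDiffAt I 𝓘(ℝ, (ι → ℝ) →L[ℝ] (ι → ℝ)) ∞ L x := by
    refine contMDiffAt_finsetSum fun i _ ↦ contMDiffAt_finsetSum fun j _ ↦ ?_
    exact (contMDiffAt_inner (hs j) (hs i)).smul contMDiffAt_const
  -- A coefficient vector killed by the Gram operator gives a vector of zero norm, so it vanishes by
  -- independence of the frame.
  have hinj : Function.Injective (L x) := by
    refine (injective_iff_map_eq_zero (L x)).2 fun c hc ↦ ?_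
    have h0 : ⟪∑ j, c j • s j x, ∑ j, c j • s j x⟫_ℝ = 0 := by
      rw [inner_sum]
      refine Finset.sum_eq_zero fun i _ ↦ ?_
      rw [inner_smul_right, ← hLapply, hc]
      simp
    rw [inner_self_eq_zero] at h0
    have hli := (e.isLocalFrameOn_localFrame_baseSet I ∞ b).linearIndependent hx
    exact funext (Fintype.linearIndependent_iff.1 hli c h0)
  let Λ : (ι → ℝ) ≃L[ℝ] (ι → ℝ) :=
    (LinearEquiv.ofInjectiveEndo (L x).toLinearMap hinj).toContinuousLinearEquiv
  have hΛ : (Λ : (ι → ℝ) →L[ℝ] (ι → ℝ)) = L x := by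
    ext c i; rfl
  have hinv : ContMDiffAt I 𝓘(ℝ, (ι → ℝ) →L[ℝ] (ι → ℝ)) ∞
      (fun y ↦ ContinuousLinearMap.inverse (L y)) x := by
    have h1 : ContMDiffAt 𝓘(ℝ, (ι → ℝ) →L[ℝ] (ι → ℝ)) 𝓘(ℝ, (ι → ℝ) →L[ℝ] (ι → ℝ)) ∞
        ContinuousLinearMap.inverse (L x) := by
      rw [← hΛ]
      exact (contDiffAt_map_inverse Λ).contMDiffAt
    exact h1.comp x hL
  let φ (y : M) : ι → ℝ := fun i ↦ ⟪W y, s i y⟫_ℝ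
  have hφ : ContMDiffAt I 𝓘(ℝ, ι → ℝ) ∞ φ x := contMDiffAt_pi_space.2 fun i ↦ h _ (hs i)
  let c (y : M) : ι → ℝ := fun i ↦ e.localFrameCoeff I b i y (W y)
  have hc : c =ᶠ[𝓝 x] fun y ↦ ContinuousLinearMap.inverse (L y) (φ y) := by
    have h1 : ∀ᶠ y in 𝓝 x, L y ∈ range ((↑) : ((ι → ℝ) ≃L[ℝ] (ι → ℝ)) → _) :=
      hL.continuousAt (hΛ ▸ Λ.nhds)
    filter_upwards [h1, e.eventually_eq_localFrame_sum_coeff_smul (I := I) b (s := W) hx]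
      with y ⟨Λy, hy⟩ hWy
    have h2 : L y (c y) = φ y := by
      ext i
      rw [hLapply]
      simp only [φ, c]
      conv_rhs => rw [hWy]
    rw [← h2, ← hy, ContinuousLinearMap.inverse_equiv]
    simp
  have hcs : ContMDiffAt I 𝓘(ℝ, ι → ℝ) ∞ c x := (hinv.clm_apply hφ).congr_of_eventuallyEq hc
  exact (contMDiffAt_iff_localFrameCoeff b hx).2 (contMDiffAt_pi_space.1 hcs)

theorem ContMDiffAt.mlieBracket_smooth {X Y : (x : M) → TangentSpace I x} {x : M}
    (hX : CMDiffAt ∞ (T% X) x) (hY : CMDiffAt ∞ (T% Y) x) :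
    CMDiffAt ∞ (T% (mlieBracket I X Y)) x :=
  have : IsManifold I (minSmoothness ℝ 2) M := by
    rw [minSmoothness_of_isRCLikeNormedField]; infer_instance
  -- The bracket costs one derivative, which is free at order infinity: `⊤ + 1 = ⊤`.
  have : IsManifold I ((⊤ : ℕ∞) + 1) M := inferInstanceAs (IsManifold I ∞ M)
  ContMDiffAt.mlieBracket_vectorField (m := ⊤) (n := ⊤) (I := I) hX hY (by simp)

theorem eventually_mdifferentiableAt {X : (x : M) → TangentSpace I x} {x : M}
    (hX : CMDiffAt ∞ (T% X) x) : ∀ᶠ y in 𝓝 x, MDiffAt (T% X) y := by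
  -- Regularity at a point spreads to a neighbourhood for finite orders, hence the reduction to
  -- order one.
  have h1 : CMDiffAt 1 (T% X) x := hX.of_le (by simp)
  filter_upwards [contMDiffAt_iff_contMDiffAt_nhds (by simp) |>.1 h1] with y hy
  exact hy.mdifferentiableAt one_ne_zero

theorem contMDiffAt_koszul {X Y Z : (x : M) → TangentSpace I x} {x : M}
    (hX : CMDiffAt ∞ (T% X) x) (hY : CMDiffAt ∞ (T% Y) x) (hZ : CMDiffAt ∞ (T% Z) x) :
    CMDiffAt ∞ (koszul X Y Z) x := by
  have h1 := contMDiffAt_mvfderiv_apply (contMDiffAt_inner hY hZ) hX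
  have h2 := contMDiffAt_mvfderiv_apply (contMDiffAt_inner hZ hX) hY
  have h3 := contMDiffAt_mvfderiv_apply (contMDiffAt_inner hX hY) hZ
  have h4 := contMDiffAt_inner (hX.mlieBracket_smooth hY) hZ
  have h5 := contMDiffAt_inner (hY.mlieBracket_smooth hZ) hX
  have h6 := contMDiffAt_inner (hZ.mlieBracket_smooth hX) hY
  exact contMDiffAt_const.mul (((((h1.add h2).sub h3).add h4).sub h5).add h6)

theorem contMDiffAt_lieDerivMetric {X Y Z : (x : M) → TangentSpace I x} {x : M}
    (hX : CMDiffAt ∞ (T% X) x) (hY : CMDiffAt ∞ (T% Y) x) (hZ : CMDiffAt ∞ (T% Z) x) :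
    CMDiffAt ∞ (lieDerivMetric X Y Z) x :=
  ((contMDiffAt_mvfderiv_apply (contMDiffAt_inner hY hZ) hX).sub
    (contMDiffAt_inner (hX.mlieBracket_smooth hY) hZ)).sub
    (contMDiffAt_inner hY (hX.mlieBracket_smooth hZ))

/-- The Levi-Civita connection is smooth. -/
theorem contMDiffAt_leviCivita {X Y : (x : M) → TangentSpace I x} {x : M}
    (hX : CMDiffAt ∞ (T% X) x) (hY : CMDiffAt ∞ (T% Y) x) :
    CMDiffAt ∞ (T% (fun y ↦ leviCivita I M Y y (X y))) x := by
  refine contMDiffAt_of_contMDiffAt_inner fun Z hZ ↦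
    (contMDiffAt_koszul hX hY hZ).congr_of_eventuallyEq ?_
  filter_upwards [eventually_mdifferentiableAt hX, eventually_mdifferentiableAt hY,
    eventually_mdifferentiableAt hZ] with y h1 h2 h3
  exact inner_leviCivita h1 h2 h3

/-! ### The Levi-Civita connection is metric and torsion-free -/

/-- When the Koszul expression is symmetrized in `Y` and `Z`, all brackets and all but one of the
derivatives cancel. -/
theorem mvfderiv_inner_leviCivita {Y Z : (x : M) → TangentSpace I x} {x : M}
    (hY : CMDiffAt ∞ (T% Y) x) (hZ : CMDiffAt ∞ (T% Z) x) (u : TangentSpace I x) :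
    mvfderiv I (fun y ↦ ⟪Y y, Z y⟫_ℝ) x u =
      ⟪leviCivita I M Y x u, Z x⟫_ℝ + ⟪Y x, leviCivita I M Z x u⟫_ℝ := by
  have hu := mdifferentiableAt_extend I E u
  have h1 := inner_leviCivita hu (hY.mdifferentiableAt (by simp)) (hZ.mdifferentiableAt (by simp))
  have h2 := inner_leviCivita hu (hZ.mdifferentiableAt (by simp)) (hY.mdifferentiableAt (by simp))
  rw [extend_apply_self] at h1 h2
  rw [real_inner_comm _ (Y x), h1, h2]
  simp only [koszul, mlieBracket_swap_apply (V := Z) (W := Y),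
    mlieBracket_swap_apply (V := Z) (W := extend E u),
    mlieBracket_swap_apply (V := Y) (W := extend E u), extend_apply_self, inner_neg_left,
    fun y ↦ real_inner_comm (Z y) (Y y), fun y ↦ real_inner_comm (extend E u y) (Y y),
    fun y ↦ real_inner_comm (extend E u y) (Z y)]
  ring

/-- Antisymmetrizing the Koszul expression in `X` and `Y` leaves only the bracket: `D` is
torsion-free. -/
theorem leviCivita_sub_leviCivita {X Y : (x : M) → TangentSpace I x} {x : M}
    (hX : MDiffAt (T% X) x) (hY : MDiffAt (T% Y) x) :
    leviCivita I M Y x (X x) - leviCivita I M X x (Y x) = mlieBracket I X Y x := by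
  refine ext_inner_right ℝ fun w ↦ ?_
  have hw := mdifferentiableAt_extend I E w
  have h1 := inner_leviCivita hX hY hw
  have h2 := inner_leviCivita hY hX hw
  rw [extend_apply_self] at h1 h2
  rw [inner_sub_left, h1, h2]
  simp only [koszul, mlieBracket_swap_apply (V := Y) (W := X),
    mlieBracket_swap_apply (V := extend E w) (W := X),
    mlieBracket_swap_apply (V := extend E w) (W := Y), extend_apply_self, inner_neg_left,
    fun y ↦ real_inner_comm (Y y) (X y), fun y ↦ real_inner_comm (extend E w y) (Y y),
    fun y ↦ real_inner_comm (extend E w y) (X y)]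
  ring

theorem lieDerivMetric_comm (X Y Z : (x : M) → TangentSpace I x) (x : M) :
    lieDerivMetric X Y Z x = lieDerivMetric X Z Y x := by
  simp only [lieDerivMetric, fun y ↦ real_inner_comm (Z y) (Y y),
    real_inner_comm _ (mlieBracket I X Z x), real_inner_comm _ (mlieBracket I X Y x)]
  ring

theorem lieDerivMetric_add_right (X : (x : M) → TangentSpace I x)
    {Y Z Z' : (x : M) → TangentSpace I x} {x : M} (hY : MDiffAt (T% Y) x)
    (hZ : MDiffAt (T% Z) x) (hZ' : MDiffAt (T% Z') x) :
    lieDerivMetric X Y (Z + Z') x = lieDerivMetric X Y Z x + lieDerivMetric X Y Z' x := by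
  have h := mvfderiv_fun_add (mdifferentiableAt_inner hY hZ) (mdifferentiableAt_inner hY hZ')
  simp [lieDerivMetric, h, mlieBracket_add_right hZ hZ', inner_add_right]
  ring

/-! ### Properties of the adapted connection -/

namespace RiemannianFoliation

variable {m : ℕ} (F : RiemannianFoliation I M m)

/-! ### The orthogonal splitting and its projections -/

theorem vert_mem (x : M) (u : TangentSpace I x) : F.vert x u ∈ F.vertical x :=
  Submodule.starProjection_apply_mem _ _

theorem hor_mem (x : M) (u : TangentSpace I x) : F.hor x u ∈ (F.vertical x)ᗮ :=
  Submodule.starProjection_apply_mem _ _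

theorem hor_eq_zero {x : M} {u : TangentSpace I x} (hu : u ∈ F.vertical x) : F.hor x u = 0 := by
  rw [hor_eq, sub_eq_zero]
  exact (Submodule.starProjection_eq_self_iff.2 hu).symm

theorem inner_hor_left (x : M) (u w : TangentSpace I x) :
    ⟪F.hor x u, w⟫_ℝ = ⟪F.hor x u, F.hor x w⟫_ℝ := by
  conv_lhs => rw [← F.hor_add_vert x w]
  simp [inner_add_right]

theorem inner_vert_left (x : M) (u w : TangentSpace I x) :
    ⟪F.vert x u, w⟫_ℝ = ⟪F.vert x u, F.vert x w⟫_ℝ := by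
  conv_lhs => rw [← F.hor_add_vert x w]
  simp [inner_add_right]

theorem inner_eq_hor_add_vert (x : M) (u w : TangentSpace I x) :
    ⟪u, w⟫_ℝ = ⟪F.hor x u, F.hor x w⟫_ℝ + ⟪F.vert x u, F.vert x w⟫_ℝ := by
  conv_lhs => rw [← F.hor_add_vert x u, ← F.hor_add_vert x w]
  simp [inner_add_right, inner_add_left]

theorem contMDiffAt_vertField {X : (x : M) → TangentSpace I x} {x : M}
    (hX : CMDiffAt ∞ (T% X) x) : CMDiffAt ∞ (T% (F.vertField X)) x :=
  ContMDiffAt.clm_bundle_apply (F₁ := E) (F₂ := E) (b := id)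
    (E₁ := fun x : M ↦ TangentSpace I x) (E₂ := fun x : M ↦ TangentSpace I x)
    (F.smooth_vertical x) hX

theorem horField_eq_sub (X : (x : M) → TangentSpace I x) :
    F.horField X = X - F.vertField X := by
  ext x; simp [horField, vertField, hor_eq]

theorem horField_add_vertField (X : (x : M) → TangentSpace I x) :
    F.horField X + F.vertField X = X := by
  rw [horField_eq_sub, sub_add_cancel]

theorem contMDiffAt_horField {X : (x : M) → TangentSpace I x} {x : M}
    (hX : CMDiffAt ∞ (T% X) x) : CMDiffAt ∞ (T% (F.horField X)) x := by
  rw [horField_eq_sub]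
  exact hX.sub_section (F.contMDiffAt_vertField hX)

@[simp] theorem horField_vertField (X : (x : M) → TangentSpace I x) :
    F.horField (F.vertField X) = 0 := by
  ext x; simp [horField, vertField]

@[simp] theorem vertField_horField (X : (x : M) → TangentSpace I x) :
    F.vertField (F.horField X) = 0 := by
  ext x; simp [horField, vertField]

@[simp] theorem vertField_vertField (X : (x : M) → TangentSpace I x) :
    F.vertField (F.vertField X) = F.vertField X := by
  ext x; simp [vertField]

/-- The defining property of the tensor `C`. -/
theorem inner_tensorC {X Y Z : (x : M) → TangentSpace I x} {x : M}
    (hY : MDiffAt (T% Y) x) (hZ : MDiffAt (T% Z) x) :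
    ⟪F.tensorC X Y x, Z x⟫_ℝ =
      (1 / 2) * lieDerivMetric (F.horField X) (F.vertField Y) (F.vertField Z) x := by
  -- The term from differentiating `f` in `⟪Y, f Z⟫` cancels the one from the bracket with `f Z`. By
  -- tensoriality, `Z` can be expanded in the orthonormal basis that defines `tensorC`.
  have hΦ : TensorialAt I E
      (fun Z ↦ lieDerivMetric (F.horField X) (F.vertField Y) (F.vertField Z) x) x :=
    { smul := by
        intro f Z hf hZ
        have hvZ := F.mdifferentiableAt_vertField hZ
        have h := mvfderiv_fun_mul hf
          (mdifferentiableAt_inner (F.mdifferentiableAt_vertField hY) hvZ)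
        rw [vertField_smul]
        simp [lieDerivMetric, inner_smul_right, h, mlieBracket_smul_right hf hvZ, inner_add_right]
        ring
      add := by
        intro Z Z' hZ hZ'
        rw [vertField_add, lieDerivMetric_add_right _ (F.mdifferentiableAt_vertField hY)
          (F.mdifferentiableAt_vertField hZ) (F.mdifferentiableAt_vertField hZ')] }
  have h1 := TensorialAt.mkHom_apply hΦ hZ
  rw [← h1]
  conv_rhs => rw [← (stdOrthonormalBasis ℝ (TangentSpace I x)).sum_repr' (Z x)]
  simp only [tensorC, sum_inner, inner_smul_left, map_sum, map_smul,
    TensorialAt.mkHom_apply_eq_extend, Finset.mul_sum]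
  refine Finset.sum_congr rfl fun i _ ↦ ?_
  simp
  ring

theorem hor_tensorC (X : (x : M) → TangentSpace I x) {Y : (x : M) → TangentSpace I x} {x : M}
    (hY : MDiffAt (T% Y) x) : F.hor x (F.tensorC X Y x) = 0 := by
  -- The test field is the horizontal part of an extension of `C_X Y` itself; its vertical part
  -- vanishes, so the pairing shows that the horizontal part of `C_X Y` has norm zero.
  have hZ := F.mdifferentiableAt_horField (mdifferentiableAt_extend I E (F.tensorC X Y x))
  have h := F.inner_tensorC (X := X) hY hZ
  rw [vertField_horField] at h
  have h0 : lieDerivMetric (F.horField X) (F.vertField Y) 0 x = 0 := by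
    simp [lieDerivMetric, mvfderiv_const]
  rw [h0, mul_zero, horField, extend_apply_self, real_inner_comm, inner_hor_left] at h
  exact inner_self_eq_zero.1 h

theorem hor_adapted {X Y : (x : M) → TangentSpace I x} {x : M}
    (hX : MDiffAt (T% X) x) (hY : MDiffAt (T% Y) x) :
    F.hor x (F.adapted Y x (X x)) =
      F.hor x (leviCivita I M (F.horField Y) x (F.horField X x))
        + F.hor x (mlieBracket I (F.vertField X) (F.horField Y) x) := by
  simp [F.adapted_apply Y hX, adaptedFun, F.hor_tensorC X hY]

theorem vert_adapted {X Y : (x : M) → TangentSpace I x} {x : M}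
    (hX : MDiffAt (T% X) x) (hY : MDiffAt (T% Y) x) :
    F.vert x (F.adapted Y x (X x)) =
      F.vert x (mlieBracket I (F.horField X) (F.vertField Y) x) + F.tensorC X Y x
        + F.vert x (leviCivita I M (F.vertField Y) x (F.vertField X x)) := by
  have h : F.vert x (F.tensorC X Y x) = F.tensorC X Y x := by
    have := F.hor_add_vert x (F.tensorC X Y x)
    rwa [F.hor_tensorC X hY, zero_add] at this
  simp [F.adapted_apply Y hX, adaptedFun, h]

/-- The splitting `TM = ℋ ⊕ 𝒱` is parallel. -/
theorem adapted_vertField {Y : (x : M) → TangentSpace I x} {x : M} (hY : MDiffAt (T% Y) x)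
    (u : TangentSpace I x) : F.adapted (F.vertField Y) x u = F.vert x (F.adapted Y x u) := by
  have hu := mdifferentiableAt_extend I E u
  have hvY := F.mdifferentiableAt_vertField hY
  have h1 := F.hor_adapted hu hvY
  have h2 := F.vert_adapted hu hvY
  have h3 := F.vert_adapted hu hY
  have h4 : F.tensorC (extend E u) (F.vertField Y) x = F.tensorC (extend E u) Y x := by
    simp [tensorC]
  simp only [extend_apply_self] at h1 h2 h3
  rw [vertField_vertField, h4] at h2
  rw [← F.hor_add_vert x (F.adapted (F.vertField Y) x u), h1, h2, h3]
  simp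

theorem adapted_horField {Y : (x : M) → TangentSpace I x} {x : M} (hY : MDiffAt (T% Y) x)
    (u : TangentSpace I x) : F.adapted (F.horField Y) x u = F.hor x (F.adapted Y x u) := by
  have h := F.adapted.isCovariantDerivativeOnUniv.add (F.mdifferentiableAt_horField hY)
    (F.mdifferentiableAt_vertField hY)
  rw [horField_add_vertField] at h
  rw [hor_eq, ← F.adapted_vertField hY, h]
  simp

/-- Polarization of the bundle-like condition, which is assumed only on the diagonal. -/
theorem lieDerivMetric_vertField_horField {X Y Z : (x : M) → TangentSpace I x} {x : M}
    (hX : CMDiffAt ∞ (T% X) x) (hY : CMDiffAt ∞ (T% Y) x) (hZ : CMDiffAt ∞ (T% Z) x) :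
    lieDerivMetric (F.vertField X) (F.horField Y) (F.horField Z) x = 0 := by
  have key (W) (hW : CMDiffAt ∞ (T% W) x) :
      lieDerivMetric (F.vertField X) (F.horField W) (F.horField W) x = 0 :=
    F.bundleLike _ _ (fun y ↦ F.vert_mem y _) (fun y ↦ F.hor_mem y _) x
      (F.contMDiffAt_vertField hX) (F.contMDiffAt_horField hW)
  have hY' := (F.contMDiffAt_horField hY).mdifferentiableAt (by simp)
  have hZ' := (F.contMDiffAt_horField hZ).mdifferentiableAt (by simp)
  have h1 := key Y hY
  have h2 := key Z hZ
  have h3 := key (Y + Z) (hY.add_section hZ)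
  have hYZ := mdifferentiableAt_add_section hY' hZ'
  rw [horField_add, lieDerivMetric_add_right _ hYZ hY' hZ',
    lieDerivMetric_comm _ (_ + _), lieDerivMetric_comm _ (_ + _),
    lieDerivMetric_add_right _ hY' hY' hZ', lieDerivMetric_add_right _ hZ' hY' hZ', h1, h2,
    lieDerivMetric_comm _ (F.horField Z)] at h3
  linarith

theorem inner_hor_comm (x : M) (u w : TangentSpace I x) :
    ⟪F.hor x u, w⟫_ℝ = ⟪u, F.hor x w⟫_ℝ := by
  rw [inner_hor_left, ← real_inner_comm, ← inner_hor_left, real_inner_comm]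

theorem inner_vert_comm (x : M) (u w : TangentSpace I x) :
    ⟪F.vert x u, w⟫_ℝ = ⟪u, F.vert x w⟫_ℝ := by
  rw [inner_vert_left, ← real_inner_comm, ← inner_vert_left, real_inner_comm]

/-- Self-adjointness moves the projections onto `Z`. The resulting scalar formula serves both the
metric property and the smoothness of `∇`. -/
theorem inner_adapted {X Y Z : (x : M) → TangentSpace I x} {x : M}
    (hX : MDiffAt (T% X) x) (hY : MDiffAt (T% Y) x) (hZ : MDiffAt (T% Z) x) :
    ⟪F.adapted Y x (X x), Z x⟫_ℝ =
      ⟪leviCivita I M (F.horField Y) x (F.horField X x), F.horField Z x⟫_ℝ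
        + ⟪mlieBracket I (F.vertField X) (F.horField Y) x, F.horField Z x⟫_ℝ
        + (⟪mlieBracket I (F.horField X) (F.vertField Y) x, F.vertField Z x⟫_ℝ
          + (1 / 2) * lieDerivMetric (F.horField X) (F.vertField Y) (F.vertField Z) x)
        + ⟪leviCivita I M (F.vertField Y) x (F.vertField X x), F.vertField Z x⟫_ℝ := by
  rw [F.adapted_apply Y hX, adaptedFun]
  simp only [inner_add_left, F.inner_tensorC hY hZ, inner_hor_comm, inner_vert_comm]
  rfl

/-- The adapted connection is metric. -/
theorem mvfderiv_inner_adapted {Y Z : (x : M) → TangentSpace I x} {x : M}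
    (hY : CMDiffAt ∞ (T% Y) x) (hZ : CMDiffAt ∞ (T% Z) x) (u : TangentSpace I x) :
    mvfderiv I (fun y ↦ ⟪Y y, Z y⟫_ℝ) x u =
      ⟪F.adapted Y x u, Z x⟫_ℝ + ⟪Y x, F.adapted Z x u⟫_ℝ := by
  have hu := contMDiffAt_extend (k := ∞) I E u
  have hu' := hu.mdifferentiableAt (by simp)
  have hY' := hY.mdifferentiableAt (by simp)
  have hZ' := hZ.mdifferentiableAt (by simp)
  have hhY := F.contMDiffAt_horField hY
  have hhZ := F.contMDiffAt_horField hZ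
  have hvY := F.contMDiffAt_vertField hY
  have hvZ := F.contMDiffAt_vertField hZ
  have hfun : (fun y ↦ ⟪Y y, Z y⟫_ℝ) = fun y ↦ ⟪F.horField Y y, F.horField Z y⟫_ℝ
      + ⟪F.vertField Y y, F.vertField Z y⟫_ℝ := by
    ext y
    exact F.inner_eq_hor_add_vert y _ _
  rw [hfun, mvfderiv_fun_add (mdifferentiableAt_inner (hhY.mdifferentiableAt (by simp))
    (hhZ.mdifferentiableAt (by simp))) (mdifferentiableAt_inner
    (hvY.mdifferentiableAt (by simp)) (hvZ.mdifferentiableAt (by simp)))]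
  have hsplit : u = F.horField (extend E u) x + F.vertField (extend E u) x := by
    simp [horField, vertField, hor_add_vert]
  have h1 := mvfderiv_inner_leviCivita hhY hhZ (F.horField (extend E u) x)
  have h2 := mvfderiv_inner_leviCivita hvY hvZ (F.vertField (extend E u) x)
  have h3 := F.lieDerivMetric_vertField_horField hu hY hZ
  have h4 := F.inner_adapted hu' hY' hZ'
  have h5 := F.inner_adapted hu' hZ' hY'
  rw [lieDerivMetric_comm _ (F.vertField Z)] at h5
  rw [extend_apply_self] at h4 h5
  rw [h4, real_inner_comm _ (Y x), h5]
  conv_lhs => rw [hsplit]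
  simp only [lieDerivMetric, real_inner_comm _ (F.horField Y x),
    real_inner_comm _ (F.vertField Y x), add_apply, map_add] at h1 h2 h3 ⊢
  -- Of the four cases, horizontal-horizontal and vertical-vertical use that `D` is metric (`h1`,
  -- `h2`), and a vertical derivative of horizontal fields uses the bundle-like condition (`h3`). In
  -- the last case the two halves contributed by `C` add up to the Lie derivative of the metric, so
  -- nothing is needed beyond its definition.
  linear_combination h1 + h2 + h3

/-- The adapted connection is smooth. -/
theorem contMDiffAt_adapted {X Y : (x : M) → TangentSpace I x} {x : M}
    (hX : CMDiffAt ∞ (T% X) x) (hY : CMDiffAt ∞ (T% Y) x) :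
    CMDiffAt ∞ (T% (fun y ↦ F.adapted Y y (X y))) x := by
  have hhX := F.contMDiffAt_horField hX
  have hvX := F.contMDiffAt_vertField hX
  have hhY := F.contMDiffAt_horField hY
  have hvY := F.contMDiffAt_vertField hY
  refine contMDiffAt_of_contMDiffAt_inner fun Z hZ ↦ ?_
  have hhZ := F.contMDiffAt_horField hZ
  have hvZ := F.contMDiffAt_vertField hZ
  have h := (((contMDiffAt_inner (contMDiffAt_leviCivita hhX hhY) hhZ).add
    (contMDiffAt_inner (hvX.mlieBracket_smooth hhY) hhZ)).add
    ((contMDiffAt_inner (hhX.mlieBracket_smooth hvY) hvZ).add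
      ((contMDiffAt_const (c := (1 / 2 : ℝ))).mul (contMDiffAt_lieDerivMetric hhX hvY hvZ)))).add
    (contMDiffAt_inner (contMDiffAt_leviCivita hvX hvY) hvZ)
  refine h.congr_of_eventuallyEq ?_
  filter_upwards [eventually_mdifferentiableAt hX, eventually_mdifferentiableAt hY,
    eventually_mdifferentiableAt hZ] with y h1 h2 h3
  exact F.inner_adapted h1 h2 h3

/-! ### The torsion of the adapted connection -/

theorem contMDiffAt_torsion {X Y : (x : M) → TangentSpace I x} {x : M}
    (hX : CMDiffAt ∞ (T% X) x) (hY : CMDiffAt ∞ (T% Y) x) :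
    CMDiffAt ∞ (T% (fun y ↦ F.adapted.torsion y (X y) (Y y))) x := by
  refine ((((F.contMDiffAt_adapted hX hY).sub_section (F.contMDiffAt_adapted hY hX)).sub_section
    (hX.mlieBracket_smooth hY))).congr_of_eventuallyEq ?_
  filter_upwards [eventually_mdifferentiableAt hX, eventually_mdifferentiableAt hY] with y h1 h2
  rw [F.adapted.torsion_apply h1 h2]
  rfl

/-- The torsion of the adapted connection is vertical. -/
theorem hor_torsion (x : M) (u w : TangentSpace I x) :
    F.hor x (F.adapted.torsion x u w) = 0 := by
  have hu := contMDiffAt_extend (k := ∞) I E u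
  have hw := contMDiffAt_extend (k := ∞) I E w
  have hu' := hu.mdifferentiableAt (by simp)
  have hw' := hw.mdifferentiableAt (by simp)
  have hhu := F.mdifferentiableAt_horField hu'
  have hvu := F.mdifferentiableAt_vertField hu'
  have hhw := F.mdifferentiableAt_horField hw'
  have hvw := F.mdifferentiableAt_vertField hw'
  have h1 := F.adapted.torsion_apply hu' hw'
  have h2 := F.hor_adapted hu' hw'
  have h3 := F.hor_adapted hw' hu'
  have h4 := leviCivita_sub_leviCivita hhu hhw
  have h5 : mlieBracket I (extend E u) (extend E w) x =
      mlieBracket I (F.horField (extend E u)) (F.horField (extend E w)) x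
      + mlieBracket I (F.horField (extend E u)) (F.vertField (extend E w)) x
      + (mlieBracket I (F.vertField (extend E u)) (F.horField (extend E w)) x
      + mlieBracket I (F.vertField (extend E u)) (F.vertField (extend E w)) x) := by
    conv_lhs =>
      rw [← F.horField_add_vertField (extend E u), ← F.horField_add_vertField (extend E w)]
    rw [mlieBracket_add_left hhu hvu, mlieBracket_add_right hhw hvw, mlieBracket_add_right hhw hvw]
  have h6 := F.hor_eq_zero (F.involutive _ _ (fun y ↦ F.vert_mem y (extend E u y))
    (fun y ↦ F.vert_mem y (extend E w y)) x (F.contMDiffAt_vertField hu)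
    (F.contMDiffAt_vertField hw))
  have h7 := mlieBracket_swap_apply (I := I) (V := F.vertField (extend E w))
    (W := F.horField (extend E u)) (x := x)
  change F.hor x (mlieBracket I (F.vertField (extend E u)) (F.vertField (extend E w)) x) = 0 at h6
  rw [extend_apply_self, extend_apply_self] at h1
  rw [extend_apply_self] at h2 h3
  rw [h1, map_sub, map_sub, h2, h3, h5, ← h4, h7]
  simp only [map_add, map_sub, map_neg, h6]
  abel

theorem vert_torsion (x : M) (u w : TangentSpace I x) :
    F.vert x (F.adapted.torsion x u w) = F.adapted.torsion x u w := by
  have := F.hor_add_vert x (F.adapted.torsion x u w)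
  rwa [hor_torsion, zero_add] at this

/-! ### The difference of the adapted and the Levi-Civita connection -/

/-- The difference `A_u w = ∇_u w - D_u w` of the adapted and the Levi-Civita connection. -/
noncomputable def contorsion (x : M) :
    TangentSpace I x →L[ℝ] TangentSpace I x →L[ℝ] TangentSpace I x :=
  (F.adapted.difference (leviCivita I M) x).flip

theorem contorsion_apply {Y : (x : M) → TangentSpace I x} {x : M} (hY : MDiffAt (T% Y) x)
    (u : TangentSpace I x) :
    F.contorsion x u (Y x) = F.adapted Y x u - leviCivita I M Y x u := by
  rw [contorsion, ContinuousLinearMap.flip_apply]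
  exact DFunLike.congr_fun (IsCovariantDerivativeOn.difference_apply F.adapted.isCovariantDerivativeOnUniv
    (leviCivita I M).isCovariantDerivativeOnUniv (by trivial) hY) u

/-- `D` has no torsion, so all the torsion of `∇` comes from the difference tensor. -/
theorem contorsion_sub_contorsion (x : M) (u w : TangentSpace I x) :
    F.contorsion x u w - F.contorsion x w u = F.adapted.torsion x u w := by
  have hu := mdifferentiableAt_extend I E u
  have hw := mdifferentiableAt_extend I E w
  have h1 := F.contorsion_apply hu w
  have h2 := F.contorsion_apply hw u
  have h3 := F.adapted.torsion_apply hu hw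
  have h4 := leviCivita_sub_leviCivita hu hw
  rw [extend_apply_self] at h1 h2
  rw [extend_apply_self, extend_apply_self] at h3 h4
  rw [h1, h2, h3, ← h4]
  abel

/-- The difference of two metric connections takes values in skew endomorphisms. -/
theorem inner_contorsion_add (x : M) (u w z : TangentSpace I x) :
    ⟪F.contorsion x u w, z⟫_ℝ + ⟪F.contorsion x u z, w⟫_ℝ = 0 := by
  have hw := contMDiffAt_extend (k := ∞) I E w
  have hz := contMDiffAt_extend (k := ∞) I E z
  have h1 := F.contorsion_apply (hw.mdifferentiableAt (by simp)) u
  have h2 := F.contorsion_apply (hz.mdifferentiableAt (by simp)) u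
  have h3 := F.mvfderiv_inner_adapted hw hz u
  have h4 := mvfderiv_inner_leviCivita hw hz u
  simp only [extend_apply_self] at h1 h2 h3 h4
  rw [h1, h2, inner_sub_left, inner_sub_left]
  rw [real_inner_comm _ w] at h3 h4
  linarith

/-- Koszul's trick: a tensor skew in its last two slots is determined by its antisymmetrization in
the first two. -/
theorem inner_contorsion (x : M) (u w z : TangentSpace I x) :
    ⟪F.contorsion x u w, z⟫_ℝ = (1 / 2) * (⟪F.adapted.torsion x u w, z⟫_ℝ
      - ⟪F.adapted.torsion x w z, u⟫_ℝ + ⟪F.adapted.torsion x z u, w⟫_ℝ) := by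
  simp only [← contorsion_sub_contorsion, inner_sub_left]
  linarith [F.inner_contorsion_add x u w z, F.inner_contorsion_add x w u z,
    F.inner_contorsion_add x z u w]

theorem inner_torsion_of_hor {x : M} {u : TangentSpace I x} (hu : F.hor x u = u)
    (w z : TangentSpace I x) : ⟪F.adapted.torsion x w z, u⟫_ℝ = 0 := by
  rw [← F.vert_torsion, ← hu, inner_vert_hor]

theorem contorsion_self {x : M} {u : TangentSpace I x} (hu : F.hor x u = u) :
    F.contorsion x u u = 0 := by
  refine ext_inner_right ℝ fun w ↦ ?_
  simp [inner_contorsion, F.inner_torsion_of_hor hu]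

/-- Of the three torsion terms in `inner_contorsion`, the one paired with `u` vanishes because
torsion is vertical, and the one paired with `v` is `J_v u` by definition. -/
theorem two_smul_contorsion {x : M} {u : TangentSpace I x} (hu : F.hor x u = u)
    (v : TangentSpace I x) :
    (2 : ℝ) • F.contorsion x v u = F.adapted.torsion x v u - F.adapted.J x v u := by
  refine ext_inner_right ℝ fun w ↦ ?_
  rw [inner_smul_left, inner_contorsion, inner_sub_left, CovariantDerivative.inner_J,
    F.inner_torsion_of_hor hu, real_inner_comm v]
  simp

/-! ### Comparison of the curvatures -/

/-- The torsion takes vertical values and `∇` preserves the vertical bundle. This is why the final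
formula can pair this term with the vertical part of the velocity only. -/
theorem vert_derivTorsion (x : M) (u v w : TangentSpace I x) :
    F.vert x (F.adapted.derivTorsion x u v w) = F.adapted.derivTorsion x u v w := by
  have hv := contMDiffAt_extend (k := ∞) I E v
  have hw := contMDiffAt_extend (k := ∞) I E w
  have hS := F.contMDiffAt_torsion hv hw
  have h1 := F.adapted_vertField (hS.mdifferentiableAt (by simp)) u
  have h2 : F.vertField (fun y ↦ F.adapted.torsion y (extend E v y) (extend E w y)) =
      fun y ↦ F.adapted.torsion y (extend E v y) (extend E w y) :=
    funext fun y ↦ F.vert_torsion y _ _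
  rw [h2] at h1
  simp only [CovariantDerivative.derivTorsion, map_sub, vert_torsion, ← h1]

/-- Substitute `D = ∇ - A` in both second derivatives and pair with `V`. The extension `X` of `u`
need not be horizontal away from `x`; this is harmless, since `⟪A_Y X, V⟫ = -⟪T(X, V), Y⟫` for `Y =
X` and `Y = V` holds for arbitrary fields, and horizontality enters only after evaluation at `x`. -/
theorem inner_curv_leviCivita {x : M} {u : TangentSpace I x} (hu : F.hor x u = u)
    (v : TangentSpace I x) :
    ⟪(leviCivita I M).curv x v u u, v⟫_ℝ = ⟪F.adapted.curv x v u u, v⟫_ℝ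
      - ⟪F.adapted.derivTorsion x u u v, v⟫_ℝ + ‖F.contorsion x v u‖ ^ 2
      - ⟪F.contorsion x v u, F.adapted.torsion x v u⟫_ℝ
      - (1 / 2) * ⟪F.adapted.torsion x (F.adapted.torsion x v u) u, v⟫_ℝ
      - (1 / 2) * ‖F.adapted.torsion x v u‖ ^ 2 := by
  let X : (y : M) → TangentSpace I y := extend E u
  let V : (y : M) → TangentSpace I y := extend E v
  have hX : CMDiffAt ∞ (T% X) x := contMDiffAt_extend (k := ∞) I E u
  have hV : CMDiffAt ∞ (T% V) x := contMDiffAt_extend (k := ∞) I E v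
  have hX' := hX.mdifferentiableAt (by simp)
  have hV' := hV.mdifferentiableAt (by simp)
  have hXx : X x = u := extend_apply_self E u
  have hVx : V x = v := extend_apply_self E v
  have hevX := eventually_mdifferentiableAt hX
  let D := leviCivita I M
  let N := F.adapted
  let S (y : M) : TangentSpace I y := N.torsion y (X y) (V y)
  have hS : CMDiffAt ∞ (T% S) x := F.contMDiffAt_torsion hX hV
  have hSx : S x = N.torsion x u v := by simp only [S, hXx, hVx]
  -- the splitting of `D_Y X` into `∇_Y X` and a tensorial term, for `Y = X` and `Y = V`
  have split (Y : (y : M) → TangentSpace I y) (hY : CMDiffAt ∞ (T% Y) x) (w : TangentSpace I x)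
      (f : M → ℝ) (f' : ℝ) (hf : mvfderiv I f x w = f')
      (hBf : ∀ᶠ y in 𝓝 x, ⟪F.contorsion y (Y y) (X y), V y⟫_ℝ = f y) :
      ⟪D (fun y ↦ D X y (Y y)) x w, v⟫_ℝ = ⟪N (fun y ↦ N X y (Y y)) x w, v⟫_ℝ
        - ⟪F.contorsion x w (N X x (Y x)), v⟫_ℝ - f'
        + ⟪F.contorsion x (Y x) u, D V x w⟫_ℝ := by
    have hDX : CMDiffAt ∞ (T% (fun y ↦ D X y (Y y))) x := contMDiffAt_leviCivita hY hX
    have hNX : CMDiffAt ∞ (T% (fun y ↦ N X y (Y y))) x := F.contMDiffAt_adapted hY hX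
    let B (y : M) : TangentSpace I y := N X y (Y y) - D X y (Y y)
    have hB : CMDiffAt ∞ (T% B) x := hNX.sub_section hDX
    have h1 := D.isCovariantDerivativeOnUniv.add (hDX.mdifferentiableAt (by simp))
      (hB.mdifferentiableAt (by simp))
    have h2 : (fun y ↦ D X y (Y y)) + B = fun y ↦ N X y (Y y) := by
      ext y; simp [B]
    rw [h2] at h1
    have h3 := F.contorsion_apply (hNX.mdifferentiableAt (by simp)) w
    have hBx : ∀ᶠ y in 𝓝 x, B y = F.contorsion y (Y y) (X y) := by
      filter_upwards [hevX] with y hy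
      rw [F.contorsion_apply hy]
    have h4 : (fun y ↦ ⟪B y, V y⟫_ℝ) =ᶠ[𝓝 x] f := by
      filter_upwards [hBx, hBf] with y hy hy'
      rw [hy, hy']
    have h5 : mvfderiv I (fun y ↦ ⟪B y, V y⟫_ℝ) x w = f' := by
      rw [← hf]
      simp only [mvfderiv, h4.mfderiv_eq]
      rfl
    rw [mvfderiv_inner_leviCivita hB hV, hBx.self_of_nhds, hXx, hVx] at h5
    have h6 : D (fun y ↦ D X y (Y y)) x w = N (fun y ↦ N X y (Y y)) x w
        - F.contorsion x w (N X x (Y x)) - D B x w := by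
      have h7 := DFunLike.congr_fun h1 w
      simp only [add_apply] at h7
      rw [h3, eq_sub_iff_add_eq, ← h7]
      abel
    rw [h6, inner_sub_left, inner_sub_left]
    linarith
  have negS (Z : (y : M) → TangentSpace I y) (hZ : CMDiffAt ∞ (T% Z) x) (w : TangentSpace I x) :
      mvfderiv I (fun y ↦ -⟪S y, Z y⟫_ℝ) x w =
        -(⟪N S x w, Z x⟫_ℝ + ⟪N.torsion x u v, N Z x w⟫_ℝ) := by
    have h := F.mvfderiv_inner_adapted hS hZ w
    have h' := mvfderiv_neg (I := I) (g := fun y ↦ ⟪S y, Z y⟫_ℝ) (x := x)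
    change mvfderiv I (-fun y ↦ ⟪S y, Z y⟫_ℝ) x w = _
    rw [h', neg_apply, h, hSx]
  have e1 := split X hX v _ _ (negS X hX v) (Filter.Eventually.of_forall fun y ↦ by
    rw [inner_contorsion, N.torsion_self, N.torsion_antisymm (V y)]
    simp only [inner_zero_left, inner_neg_left, S, N]
    ring)
  have e2 := split V hV u _ _ (negS V hV u) (Filter.Eventually.of_forall fun y ↦ by
    rw [inner_contorsion, N.torsion_self, N.torsion_antisymm (V y)]
    simp only [inner_zero_left, inner_neg_left, S, N]
    ring)
  -- `S` is a vertical field, hence so is its `∇`-derivative, while `u` is horizontal.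
  have hSu : ⟪N S x v, u⟫_ℝ = 0 := by
    have h1 := F.adapted_vertField (hS.mdifferentiableAt (by simp)) v
    have h2 : F.vertField S = S := funext fun y ↦ F.vert_torsion y _ _
    rw [h2] at h1
    change ⟪F.adapted S x v, u⟫_ℝ = 0
    rw [h1, ← hu, inner_vert_hor]
  have hbr := N.torsion_apply hV' hX'
  have hDV := F.contorsion_apply hV' u
  have hDX := F.contorsion_apply hX' (mlieBracket I V X x)
  have hcomm := F.contorsion_sub_contorsion x v u
  have hcurvD : D.curv x v u u = D (fun y ↦ D X y (X y)) x v - D (fun y ↦ D X y (V y)) x u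
    - D X x (mlieBracket I V X x) := rfl
  have hcurvN : N.curv x v u u = N (fun y ↦ N X y (X y)) x v - N (fun y ↦ N X y (V y)) x u
    - N X x (mlieBracket I V X x) := rfl
  have hderiv : N.derivTorsion x u u v = N S x u - N.torsion x (N X x u) v
    - N.torsion x u (N V x u) := rfl
  have hbr' : mlieBracket I V X x = N X x v - N V x u - N.torsion x v u := by
    rw [hVx, hXx] at hbr
    rw [hbr]
    abel
  have hDV' : D V x u = N V x u - F.contorsion x v u + N.torsion x v u := by
    rw [hVx] at hDV
    change _ = N V x u - D V x u at hDV
    change _ = N.torsion x v u at hcomm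
    rw [← hcomm, hDV]
    abel
  have hDX' : D X x (mlieBracket I V X x) = N X x (mlieBracket I V X x)
      - F.contorsion x (mlieBracket I V X x) u := by
    rw [hXx] at hDX
    rw [hDX]
    change _ = N X x _ - (N X x _ - D X x _)
    abel
  change ⟪D.curv x v u u, v⟫_ℝ =
    ⟪N.curv x v u u, v⟫_ℝ - ⟪N.derivTorsion x u u v, v⟫_ℝ + _ - _ - _ - _
  have hT (z : TangentSpace I x) : ⟪F.adapted.torsion x v z, v⟫_ℝ =
      -⟪F.adapted.torsion x z v, v⟫_ℝ := by
    rw [F.adapted.torsion_antisymm, inner_neg_left]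
  have hT' (z : TangentSpace I x) : ⟪F.adapted.torsion x u z, v⟫_ℝ =
      -⟪F.adapted.torsion x z u, v⟫_ℝ := by
    rw [F.adapted.torsion_antisymm, inner_neg_left]
  have hT'' (z : TangentSpace I x) : ⟪F.adapted.torsion x u v, z⟫_ℝ =
      -⟪F.adapted.torsion x v u, z⟫_ℝ := by
    rw [F.adapted.torsion_antisymm, inner_neg_left]
  have hu0 := F.inner_torsion_of_hor hu
  have hAL := F.inner_contorsion x v u (N V x u)
  have hAN := F.inner_contorsion x v (N X x u) v
  have hAK := F.inner_contorsion x u (N X x v) v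
  have hAbr := F.inner_contorsion x (mlieBracket I V X x) u v
  -- `A_u u = 0` removes the term containing `D_v V`, which depends on the choice of extension.
  rw [hXx, hSu, F.contorsion_self hu, inner_zero_left] at e1
  rw [hVx, hDV', inner_add_right, inner_sub_right, hAL] at e2
  rw [hAN] at e1
  rw [hAK] at e2
  rw [hcurvD, hcurvN, hderiv, hDX']
  simp only [inner_sub_left] at e1 e2 ⊢
  rw [e1, e2, hAbr, hbr']
  -- With the bracket written through `∇` and `T`, the remaining first derivatives of the extensions
  -- cancel.
  simp only [inner_sub_left, inner_sub_right, map_sub, sub_apply, hu0, hT, hT', hT'',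
    CovariantDerivative.torsion_self, real_inner_self_eq_norm_sq, inner_zero_left, N]
  ring

end RiemannianFoliation

/-! ### Covariant derivatives along curves -/

/-- The extension is constant in a trivialization, which is linear on fibres over its base set.
Agreement near `x` suffices, covariant derivatives being local. -/
theorem eventually_extend_add {x : M} (u w : TangentSpace I x) :
    ∀ᶠ y in 𝓝 x, extend E (u + w) y = (extend E u + extend E w : (y : M) → TangentSpace I y) y := by
  let e := trivializationAt E (TangentSpace I : M → Type _) x
  have hx : x ∈ e.baseSet := FiberBundle.mem_baseSet_trivializationAt' x
  filter_upwards [e.open_baseSet.mem_nhds hx] with y hy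
  change e.symm y (e ⟨x, u + w⟩).2 = e.symm y (e ⟨x, u⟩).2 + e.symm y (e ⟨x, w⟩).2
  rw [(e.linear ℝ hx).map_add u w]
  simp only [← e.symmL_apply (R := ℝ) hy, map_add]

theorem eventually_extend_smul {x : M} (a : ℝ) (u : TangentSpace I x) :
    ∀ᶠ y in 𝓝 x, extend E (a • u) y = (a • extend E u : (y : M) → TangentSpace I y) y := by
  let e := trivializationAt E (TangentSpace I : M → Type _) x
  have hx : x ∈ e.baseSet := FiberBundle.mem_baseSet_trivializationAt' x
  filter_upwards [e.open_baseSet.mem_nhds hx] with y hy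
  change e.symm y (e ⟨x, a • u⟩).2 = a • e.symm y (e ⟨x, u⟩).2
  rw [(e.linear ℝ hx).map_smul a u]
  simp only [← e.symmL_apply (R := ℝ) hy, map_smul]

/-- The map `w ↦ ∇_v W`, where `W` is the extension of `w` that is constant in a trivialization. -/
noncomputable def CovariantDerivative.covExtend
    (cov : CovariantDerivative I E (TangentSpace I : M → Type _))
    (x : M) (v : TangentSpace I x) : TangentSpace I x →ₗ[ℝ] TangentSpace I x where
  toFun w := cov (extend E w) x v
  map_add' u w := by
    have hu := mdifferentiableAt_extend I E u
    have hw := mdifferentiableAt_extend I E w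
    rw [cov.isCovariantDerivativeOnUniv.congr_of_eventuallyEq (mdifferentiableAt_extend I E _)
      (mdifferentiableAt_add_section hu hw) Filter.univ_mem (eventually_extend_add u w),
      cov.isCovariantDerivativeOnUniv.add hu hw]
    rfl
  map_smul' a w := by
    have hw := mdifferentiableAt_extend I E w
    have haw : MDiffAt (T% (a • (extend E w : (y : M) → TangentSpace I y))) x :=
      (mdifferentiableAt_const (c := a)).smul_section hw
    rw [cov.isCovariantDerivativeOnUniv.congr_of_eventuallyEq (mdifferentiableAt_extend I E _)
      haw Filter.univ_mem (eventually_extend_smul a w),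
      cov.isCovariantDerivativeOnUniv.smul_const a hw]
    rfl

/-- The Leibniz rule for a linear combination, with coefficients depending on time, of restrictions
of vector fields to a curve. -/
theorem CovariantDerivative.along_sum_smul
    (cov : CovariantDerivative I E (TangentSpace I : M → Type _)) {ι : Type*} [Fintype ι]
    {s : Set ℝ} {γ : ℝ → M} {t : ℝ} {c : ι → ℝ → ℝ} {Y : ι → (x : M) → TangentSpace I x}
    {X : (t : ℝ) → TangentSpace I (γ t)}
    (hX : ∀ᶠ τ in 𝓝[s] t, X τ = ∑ i, c i τ • Y i (γ τ)) (ht : t ∈ s)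
    (hc : ∀ i, DifferentiableWithinAt ℝ (c i) s t) (hY : ∀ i, MDiffAt (T% (Y i)) (γ t))
    (hγ : MDifferentiableWithinAt 𝓘(ℝ, ℝ) I γ s t) (hs : UniqueDiffWithinAt ℝ s t) :
    cov.along s γ X t = ∑ i, (derivWithin (c i) s t • Y i (γ t)
      + c i t • cov (Y i) (γ t) (curveVelocity I s γ t)) := by
  let e := trivializationAt E (TangentSpace I : M → Type _) (γ t)
  have hmem : γ t ∈ e.baseSet := FiberBundle.mem_baseSet_trivializationAt' (γ t)
  let a (i : ι) (y : M) : E := (e ⟨y, Y i y⟩).2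
  have ha (i : ι) : MDifferentiableAt I 𝓘(ℝ, E) (a i) (γ t) :=
    (e.mdifferentiableAt_section_iff I (Y i) hmem).1 (hY i)
  have haγ (i : ι) : DifferentiableWithinAt ℝ (fun τ ↦ a i (γ τ)) s t :=
    mdifferentiableWithinAt_iff_differentiableWithinAt.1
      ((ha i).comp_mdifferentiableWithinAt t hγ)
  have hbase : ∀ᶠ τ in 𝓝[s] t, γ τ ∈ e.baseSet :=
    hγ.continuousWithinAt (e.open_baseSet.mem_nhds hmem)
  have hcoord : (fun τ ↦ (e ⟨γ τ, X τ⟩).2) =ᶠ[𝓝[s] t] fun τ ↦ ∑ i, c i τ • a i (γ τ) := by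
    filter_upwards [hX, hbase] with τ h1 h2
    rw [h1]
    have h3 (w : TangentSpace I (γ τ)) : (e ⟨γ τ, w⟩).2 = e.linearMapAt ℝ (γ τ) w := by
      rw [e.coe_linearMapAt_of_mem h2]
    simp only [a, h3, map_sum, map_smul]
  have hderiv : derivWithin (fun τ ↦ (e ⟨γ τ, X τ⟩).2) s t =
      ∑ i, (c i t • derivWithin (fun τ ↦ a i (γ τ)) s t + derivWithin (c i) s t • a i (γ t)) := by
    rw [hcoord.derivWithin_eq_of_mem ht, derivWithin_fun_sum fun i _ ↦ (hc i).fun_smul (haγ i)]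
    exact Finset.sum_congr rfl fun i _ ↦ derivWithin_fun_smul (hc i) (haγ i)
  -- `along_comp` splits each `∇ Yᵢ` into a coordinate derivative and a part linear in the value of
  -- `Yᵢ`, matching the two terms in the definition of `along`.
  have halong (i : ι) : cov (Y i) (γ t) (curveVelocity I s γ t) =
      e.symmL ℝ (γ t) (derivWithin (fun τ ↦ a i (γ τ)) s t)
        + cov.covExtend (γ t) (curveVelocity I s γ t) (Y i (γ t)) := by
    rw [← cov.along_comp (hY i) hγ hs, e.symmL_apply hmem]
    rfl
  have hasymm (i : ι) : e.symmL ℝ (γ t) (a i (γ t)) = Y i (γ t) := by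
    simp [a, hmem]
  have hXt : cov (extend E (X t)) (γ t) (curveVelocity I s γ t) =
      ∑ i, c i t • cov.covExtend (γ t) (curveVelocity I s γ t) (Y i (γ t)) := by
    rw [hX.self_of_nhdsWithin ht]
    change cov.covExtend (γ t) (curveVelocity I s γ t) _ = _
    simp only [map_sum, map_smul]
  have hgoal : cov.along s γ X t =
      e.symmL ℝ (γ t) (derivWithin (fun τ ↦ (e ⟨γ τ, X τ⟩).2) s t)
        + cov (extend E (X t)) (γ t) (curveVelocity I s γ t) := by
    rw [e.symmL_apply hmem]; rfl
  rw [hgoal, hderiv, hXt, map_sum, ← Finset.sum_add_distrib]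
  refine Finset.sum_congr rfl fun i _ ↦ ?_
  rw [halong, map_add, map_smul, map_smul, hasymm]
  module

/-- The coordinate derivative does not involve the connection, so it drops out of the difference. -/
theorem CovariantDerivative.along_sub_along
    (cov cov' : CovariantDerivative I E (TangentSpace I : M → Type _)) (s : Set ℝ) (γ : ℝ → M)
    (X : (t : ℝ) → TangentSpace I (γ t)) (t : ℝ) :
    cov.along s γ X t - cov'.along s γ X t =
      cov (extend E (X t)) (γ t) (curveVelocity I s γ t)
        - cov' (extend E (X t)) (γ t) (curveVelocity I s γ t) := by
  simp only [CovariantDerivative.along]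
  abel

/-! ### Horizontal fields along curves -/

namespace RiemannianFoliation

variable {m : ℕ} (F : RiemannianFoliation I M m)

theorem hor_of_mem {x : M} {u : TangentSpace I x} (hu : u ∈ F.horizontal x) : F.hor x u = u :=
  Submodule.starProjection_eq_self_iff.2 hu

/-- The adapted derivative along a curve of a horizontal vector field is horizontal. -/
theorem hor_along {s : Set ℝ} {γ : ℝ → M} {t : ℝ} {X : (t : ℝ) → TangentSpace I (γ t)}
    (hX : MDifferentiableWithinAt 𝓘(ℝ, ℝ) I.tangent
      (fun t ↦ (⟨γ t, X t⟩ : TangentBundle I M)) s t)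
    (hXH : ∀ τ ∈ s, X τ ∈ F.horizontal (γ τ)) (ht : t ∈ s) (hs : UniqueDiffWithinAt ℝ s t) :
    F.hor (γ t) (F.adapted.along s γ X t) = F.adapted.along s γ X t := by
  let e := trivializationAt E (TangentSpace I : M → Type _) (γ t)
  have hmem : γ t ∈ e.baseSet := FiberBundle.mem_baseSet_trivializationAt' (γ t)
  obtain ⟨hγ, hcX⟩ := (mdifferentiableWithinAt_totalSpace _ _).1 hX
  have hcX' : DifferentiableWithinAt ℝ (fun τ ↦ (e ⟨γ τ, X τ⟩).2) s t :=
    mdifferentiableWithinAt_iff_differentiableWithinAt.1 hcX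
  let b := Module.finBasis ℝ E
  let c (i) (τ : ℝ) : ℝ := b.repr (e ⟨γ τ, X τ⟩).2 i
  have hc (i) : DifferentiableWithinAt ℝ (c i) s t :=
    ((b.coord i).toContinuousLinearMap.differentiableAt).comp_differentiableWithinAt t hcX'
  let Y (i) : (y : M) → TangentSpace I y := extend E (e.symmL ℝ (γ t) (b i))
  have hY (i) : MDiffAt (T% (Y i)) (γ t) := mdifferentiableAt_extend I E _
  have hYe (i) {y : M} (hy : y ∈ e.baseSet) : Y i y = e.symmL ℝ y (b i) := by
    change e.symm y (e ⟨γ t, e.symmL ℝ (γ t) (b i)⟩).2 = _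
    rw [e.symmL_apply hmem, e.symmL_apply hy, e.apply_mk_symm hmem]
  have hbase : ∀ᶠ τ in 𝓝[s] t, γ τ ∈ e.baseSet :=
    hγ.continuousWithinAt (e.open_baseSet.mem_nhds hmem)
  -- Projecting the frame expansion leaves the horizontal `X` unchanged, so `X` combines the
  -- projected frame fields, whose `∇`-derivatives are horizontal. These fields need not be
  -- independent, and `along_sum_smul` does not ask for it.
  have hsum : ∀ᶠ τ in 𝓝[s] t, X τ = ∑ i, c i τ • F.horField (Y i) (γ τ) := by
    filter_upwards [hbase, self_mem_nhdsWithin] with τ h1 h2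
    have h3 : X τ = ∑ i, c i τ • Y i (γ τ) := by
      simp only [hYe _ h1, ← map_smul, ← map_sum, c, b.sum_repr]
      rw [e.symmL_apply h1, e.symm_apply_apply_mk h1]
    conv_lhs => rw [← F.hor_of_mem (hXH τ h2), h3]
    simp only [map_sum, map_smul, horField]
  rw [F.adapted.along_sum_smul hsum ht hc (fun i ↦ F.mdifferentiableAt_horField (hY i)) hγ hs]
  simp only [map_sum, map_add, map_smul, F.adapted_horField (hY _), horField, hor_hor]

/-! ### The index form -/

/-- Complete the square in `a`, which is orthogonal to the torsion; here `a` plays the role of `∇_v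
X`. The term `|A_v u|²` cancels against the curvature comparison. -/
theorem indexForm_integrand_eq {x : M} {a u v : TangentSpace I x} (ha : F.hor x a = a)
    (hu : F.hor x u = u) :
    ‖a - F.contorsion x v u‖ ^ 2 - ⟪(leviCivita I M).curv x v u u, v⟫_ℝ =
      ‖a + (1 / 2 : ℝ) • F.hor x (F.adapted.J x v u)‖ ^ 2
        - ⟪F.adapted.curv x v u u, v⟫_ℝ
        + ⟪F.adapted.derivTorsion x u u v, F.vert x v⟫_ℝ
        - (1 / 4) * ‖F.hor x (F.adapted.J x v u)‖ ^ 2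
        + ‖F.adapted.torsion x u v‖ ^ 2
        + ⟪F.adapted.torsion x (F.adapted.torsion x v u) u, v⟫_ℝ := by
  have h1 := F.inner_curv_leviCivita hu v
  have h2 := F.two_smul_contorsion hu v
  have h3 : ⟪F.adapted.derivTorsion x u u v, F.vert x v⟫_ℝ =
      ⟪F.adapted.derivTorsion x u u v, v⟫_ℝ := by
    rw [← inner_vert_comm, vert_derivTorsion]
  have h4 : ‖F.adapted.torsion x u v‖ = ‖F.adapted.torsion x v u‖ := by
    rw [F.adapted.torsion_antisymm, norm_neg]
  have h5 : ⟪a, F.adapted.torsion x v u⟫_ℝ = 0 := by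
    rw [real_inner_comm, F.inner_torsion_of_hor ha]
  have h6 : ⟪a, F.hor x (F.adapted.J x v u)⟫_ℝ = ⟪a, F.adapted.J x v u⟫_ℝ := by
    rw [← inner_hor_comm, ha]
  have h7 : 2 * ⟪a, F.contorsion x v u⟫_ℝ = -⟪a, F.adapted.J x v u⟫_ℝ := by
    rw [← inner_smul_right, h2, inner_sub_right, h5, zero_sub]
  have h8 : 2 * ⟪F.contorsion x v u, F.adapted.torsion x v u⟫_ℝ =
      ‖F.adapted.torsion x v u‖ ^ 2
        + ⟪F.adapted.torsion x (F.adapted.torsion x v u) u, v⟫_ℝ := by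
    have h := congrArg (fun z ↦ ⟪z, F.adapted.torsion x v u⟫_ℝ) h2
    simp only [inner_smul_left, inner_sub_left, real_inner_self_eq_norm_sq,
      CovariantDerivative.inner_J] at h
    rw [F.adapted.torsion_antisymm u, inner_neg_right, real_inner_comm _ v] at h
    simpa using h
  rw [h1, h3, h4, norm_sub_sq_real, norm_add_sq_real, norm_smul, inner_smul_right, h6, mul_pow]
  norm_num
  linarith

/-- The index form of a horizontal vector field in terms of the adapted connection. -/
theorem indexForm_eq {r : ℝ} (hr : 0 ≤ r) {γ : ℝ → M} (X : (t : ℝ) → TangentSpace I (γ t))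
    (hX : ContMDiffOn 𝓘(ℝ, ℝ) I.tangent ∞
      (fun t ↦ (⟨γ t, X t⟩ : TangentBundle I M)) (Icc 0 r))
    (hXH : ∀ t ∈ Icc 0 r, X t ∈ F.horizontal (γ t)) :
    indexForm γ r X = ∫ t in (0 : ℝ)..r,
      (let v : TangentSpace I (γ t) := curveVelocity I (Icc 0 r) γ t
       ‖F.adapted.along (Icc 0 r) γ X t
            + (1 / 2 : ℝ) • F.hor (γ t) (F.adapted.J (γ t) v (X t))‖ ^ 2
          - ⟪F.adapted.curv (γ t) v (X t) (X t), v⟫_ℝ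
          + ⟪F.adapted.derivTorsion (γ t) (X t) (X t) v, F.vert (γ t) v⟫_ℝ
          - (1 / 4) * ‖F.hor (γ t) (F.adapted.J (γ t) v (X t))‖ ^ 2
          + ‖F.adapted.torsion (γ t) (X t) v‖ ^ 2
          + ⟪F.adapted.torsion (γ t) (F.adapted.torsion (γ t) v (X t)) (X t), v⟫_ℝ) := by
  -- Derivatives within `Icc 0 r` are unique only if `0 < r`; for `r = 0` both integrals vanish.
  rcases hr.eq_or_lt with rfl | hr'
  · simp [indexForm]
  refine intervalIntegral.integral_congr fun t ht ↦ ?_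
  rw [uIcc_of_le hr] at ht
  have ha := F.hor_along ((hX t ht).mdifferentiableWithinAt (by simp)) hXH ht
    (uniqueDiffOn_Icc hr' t ht)
  have hD : (leviCivita I M).along (Icc 0 r) γ X t = F.adapted.along (Icc 0 r) γ X t
      - F.contorsion (γ t) (curveVelocity I (Icc 0 r) γ t) (X t) := by
    have h := F.contorsion_apply (mdifferentiableAt_extend I E (X t))
      (curveVelocity I (Icc 0 r) γ t)
    rw [extend_apply_self] at h
    rw [h, ← CovariantDerivative.along_sub_along]
    abel
  simp only [hD]
  exact F.indexForm_integrand_eq ha (F.hor_of_mem (hXH t ht))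

end RiemannianFoliation

end IndexFormula

theorem mainTheorem10 {n m : ℕ} {M : Type*} [TopologicalSpace M]
    [ChartedSpace (EuclideanSpace ℝ (Fin (n + m))) M] [IsManifold (𝓡 (n + m)) ∞ M]
    [RiemannianBundle (fun x : M ↦ TangentSpace (𝓡 (n + m)) x)]
    [IsContMDiffRiemannianBundle (𝓡 (n + m)) ∞ (EuclideanSpace ℝ (Fin (n + m)))
      (fun x : M ↦ TangentSpace (𝓡 (n + m)) x)]
    (F : RiemannianFoliation (𝓡 (n + m)) M m)
    {r : ℝ} (hr : 0 ≤ r) {γ : ℝ → M} (hγ : IsUnitSpeedGeodesic (𝓡 (n + m)) γ r)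
    (X : (t : ℝ) → TangentSpace (𝓡 (n + m)) (γ t))
    (hX : ContMDiffOn 𝓘(ℝ, ℝ) (𝓡 (n + m)).tangent ∞
      (fun t ↦ (⟨γ t, X t⟩ : TangentBundle (𝓡 (n + m)) M)) (Icc 0 r))
    (hXH : ∀ t ∈ Icc 0 r, X t ∈ F.horizontal (γ t)) :
    indexForm γ r X = ∫ t in (0 : ℝ)..r,
      (let v : TangentSpace (𝓡 (n + m)) (γ t) := curveVelocity (𝓡 (n + m)) (Icc 0 r) γ t
       ‖F.adapted.along (Icc 0 r) γ X t
            + (1 / 2 : ℝ) • F.hor (γ t) (F.adapted.J (γ t) v (X t))‖ ^ 2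
          - ⟪F.adapted.curv (γ t) v (X t) (X t), v⟫_ℝ
          + ⟪F.adapted.derivTorsion (γ t) (X t) (X t) v, F.vert (γ t) v⟫_ℝ
          - (1 / 4) * ‖F.hor (γ t) (F.adapted.J (γ t) v (X t))‖ ^ 2
          + ‖F.adapted.torsion (γ t) (X t) v‖ ^ 2
          + ⟪F.adapted.torsion (γ t) (F.adapted.torsion (γ t) v (X t)) (X t), v⟫_ℝ) :=
  F.indexForm_eq hr X hX hXH
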